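/- Let $\ell\ge 5$ and $m=2\ell$, and let $(s_0,s_1,s_2,s_3)=(2,4,1,3)$, $(t_0,t_1,t_2,t_3)=(1,3,2,4)$. An $(n_k)$ configuration is a set of $n$ points and $n$ lines of a plane such that each of the lines contains exactly $k$ of the points and each of the points lies on exactly $k$ of the lines. The trivial celestial configuration $2\ell\#(2,1;4,3;1,2;3,4)$ is constructed in the Euclidean plane as follows: $(v_0)_i$ is the point of the unit circle at angle $2\pi i/m$; for $j=0,1,2,3$, $(L_j)_i$ is the line through $(v_j)_i$ and $(v_j)_{i+s_j}$; and for $j=0,1,2$, $(v_{j+1})_i$ is the intersection point of $(L_j)_i$ and $(L_j)_{i-t_j}$ (indices $i$ modulo $m$). Thus $(v_j)_i$ has distance $\prod_{a<j}\cos(s_a\pi/m)/\cos(t_a\pi/m)$ from the origin and angle $\sum_{a<j}(s_a-t_a)\pi/m+2\pi i/m$. A diameter is a line through the origin and one of the points $(v_0)_i$; a mid-diameter is a diameter rotated by $\pi/m$ about the origin. Let $\mathcal D_4(\ell)$ be the system, in the extended Euclidean plane $\mathbb E^{2+}$ (the real projective plane), that consists of the points $(v_j)_i$ and the points at infinity of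 all diameters and mid-diameters, and of the lines $(L_j)_i$, all diameters and all mid-diameters. Then: 1. The $(v_j)_i$ and $(L_j)_i$ form a celestial $((8\ell)_4)$ configuration: the points $(v_j)_i$ ($0\le j\le 3$, $i\in\mathbb Z_m$) are distinct, each class $v_j$ is invariant under the rotation by $2\pi/m$ about the origin, which maps $(v_j)_i$ to $(v_j)_{i+1}$, and $(L_j)_i$ contains exactly the points $(v_j)_i$, $(v_j)_{i+s_j}$, $(v_{j+1})_i$, $(v_{j+1})_{i+t_j}$ among them, where $v_4=v_0$. 2. $\mathcal D_4(\ell)$ is a $((10\ell)_5)$ configuration in $\mathbb E^{2+}$. 3. Every projective transformation of $\mathbb E^{2+}$ that maps all points of $\mathcal D_4(\ell)$ to finite points maps $\mathcal D_4(\ell)$ to a $((10\ell)_5)$ configuration in the Euclidean plane $\mathbb E^2$ that has independent pencils of $p=1$ and $q=1$ parallel lines, that is, two non-parallel lines with no common configuration point. 4. There is such a projective transformation for which $p=q=1$ is also the largest possible value: whenever the image has a pencil of $p$ parallel lines and a pencil of $q$ parallel lines in different directions such that no configuration point lies on a line of both, then $p\le 1$ and $q\le 1$. -/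

import Mathlib

open scoped LinearAlgebra.Projectivization

noncomputable section

namespace D4Config

/-- The Euclidean plane. -/
abbrev Plane : Type := EuclideanSpace ℝ (Fin 2)

/-- The extended Euclidean plane: the real projective plane, in homogeneous coordinates
`[x : y : z]`, with `z = 0` as the line at infinity. -/
abbrev ExtPlane : Type := ℙ ℝ (Fin 3 → ℝ)

/-- The finite point `[x : y : 1]` of the extended plane. -/
def toExt (x : Plane) : ExtPlane :=
  Projectivization.mk ℝ ![x 0, x 1, 1] (fun h => by simpa using congrFun h 2)

/-- The points at infinity. -/
def lineAtInfinity : Set ExtPlane := {x | x.rep 2 = 0}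

/-- The projective line that joins two distinct points `a`, `b`. -/
def join (a b : ExtPlane) : Set ExtPlane := {x | x.submodule ≤ a.submodule ⊔ b.submodule}

/-- The set of all lines of the extended plane. -/
def extLines : Set (Set ExtPlane) := {l | ∃ a b, a ≠ b ∧ l = join a b}

/-- The set of all straight lines of the Euclidean plane. -/
def planeLines : Set (Set Plane) :=
  {l | ∃ a b : Plane, a ≠ b ∧ l = (affineSpan ℝ {a, b} : Set Plane)}

/-- `P` and `L` form an `(n_k)` configuration of points and lines, where `lines` is the set of
all lines of the ambient plane: `n` points and `n` lines, every line in `L` passes through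
exactly `k` points of `P`, and every point of `P` lies on exactly `k` lines of `L`. -/
structure IsConfiguration {X : Type} (lines : Set (Set X)) (n k : ℕ)
    (P : Set X) (L : Set (Set X)) : Prop where
  isLine : L ⊆ lines
  card_points : P.encard = n
  card_lines : L.encard = n
  points_on_line : ∀ l ∈ L, {p ∈ P | p ∈ l}.encard = k
  lines_through_point : ∀ p ∈ P, {l ∈ L | p ∈ l}.encard = k

/-- The rotation of the Euclidean plane about the origin by the angle `θ`. -/
def rotate (θ : ℝ) (x : Plane) : Plane :=
  !₂[Real.cos θ * x 0 - Real.sin θ * x 1, Real.sin θ * x 0 + Real.cos θ * x 1]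

/-! ### Celestial configurations

A symbol `m#(s₁,t₁;…;s_h,t_h)` is given by `m` and `s t : Fin h → ℕ`. The point classes
`v j` are indexed by integers that are read modulo `m`; the centre is the origin. -/

section Celestial

variable {h : ℕ}

/-- The line `(L_j)_i` joins the points `(v_j)_i` and `(v_j)_{i + s_j}`. -/
def celestialLine (s : Fin h → ℕ) (v : Fin h → ℤ → Plane) (j : Fin h) (i : ℤ) : Set ExtPlane :=
  join (toExt (v j i)) (toExt (v j (i + s j)))

/-- All the points `(v_j)_i`, in the extended plane. -/
def celestialPoints (v : Fin h → ℤ → Plane) : Set ExtPlane :=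
  {x | ∃ j i, x = toExt (v j i)}

/-- All the lines `(L_j)_i`. -/
def celestialLines (s : Fin h → ℕ) (v : Fin h → ℤ → Plane) : Set (Set ExtPlane) :=
  {l | ∃ j i, l = celestialLine s v j i}

/-- The twist `δ = ½ ∑ (s_j - t_j)`. -/
def twist (s t : Fin h → ℕ) : ℤ := (∑ j, ((s j : ℤ) - t j)) / 2

/-- The points `v` form a celestial 4-configuration with symbol `m#(s₁,t₁;…;s_h,t_h)`: an
`((mh)_4)` configuration with `h` classes of points and lines under the rotations by multiples
of `2π/m`, whose incidences are exactly those of the reduced Levi graph: `(L_j)_i` contains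
`(v_j)_i`, `(v_j)_{i+s_j}`, `(v_{j+1})_i`, `(v_{j+1})_{i+t_j}`, except that the last class of
lines meets the first class of points with all indices shifted by the twist. -/
structure IsCelestial (m : ℕ) (s t : Fin h → ℕ) (v : Fin h → ℤ → Plane) : Prop where
  twist_int : Even (∑ j, ((s j : ℤ) - t j))
  rotate_eq : ∀ j i, v j (i + 1) = rotate (2 * Real.pi / m) (v j i)
  eq_iff : ∀ j j' i i', v j i = v j' i' ↔ j = j' ∧ i ≡ i' [ZMOD m]
  isConfiguration :
    IsConfiguration extLines (m * h) 4 (celestialPoints v) (celestialLines s v)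
  mem_iff : ∀ a k j i, toExt (v a k) ∈ celestialLine s v j i ↔
    (a = j ∧ (k ≡ i [ZMOD m] ∨ k ≡ i + s j [ZMOD m])) ∨
    (a = finRotate h j ∧
      (k ≡ i + (if (j : ℕ) + 1 = h then twist s t else 0) [ZMOD m] ∨
       k ≡ i + t j + (if (j : ℕ) + 1 = h then twist s t else 0) [ZMOD m]))

/-- The standard construction of the points of a celestial configuration. The point `(v_0)_i`
is the vertex at angle `2πi/m` of a regular `m`-gon on the unit circle, and `(v_{j+1})_i` is the
intersection of `(L_j)_i` and `(L_j)_{i - t_j}`. The lines `(L_j)_i` are at distance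
`r_j cos(s_j π/m)` from the origin if `r_j` is the radius of the class `v_j`, so that
`r_{j+1} = r_j cos(s_j π/m) / cos(t_j π/m)`, and the angle of the point increases by
`(s_j - t_j) π/m`. -/
def celestialPoint (m : ℕ) (s t : Fin h → ℕ) (j : Fin h) (i : ℤ) : Plane :=
  let r : ℝ := ∏ a ∈ Finset.Iio j, Real.cos (s a * Real.pi / m) / Real.cos (t a * Real.pi / m)
  let θ : ℝ := (∑ a ∈ Finset.Iio j, ((s a : ℝ) - t a)) * Real.pi / m + 2 * Real.pi * i / m
  !₂[r * Real.cos θ, r * Real.sin θ]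

end Celestial

/-! ### The construction `D₄(ℓ)` -/

/-- The spans `s_j` of the symbol `2ℓ#(2,1;4,3;1,2;3,4)`. -/
def spanS : Fin 4 → ℕ := ![2, 4, 1, 3]

/-- The spans `t_j` of the symbol `2ℓ#(2,1;4,3;1,2;3,4)`. -/
def spanT : Fin 4 → ℕ := ![1, 3, 2, 4]

/-- The points `(v_j)_i` of `2ℓ#(2,1;4,3;1,2;3,4)`. -/
def basePoint (ℓ : ℕ) : Fin 4 → ℤ → Plane := celestialPoint (2 * ℓ) spanS spanT

/-- The diameters: the lines through the centre and a point of the class `v_0`. -/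
def diameters (ℓ : ℕ) : Set (Set ExtPlane) :=
  {l | ∃ i, l = join (toExt 0) (toExt (basePoint ℓ 0 i))}

/-- The mid-diameters: the diameters rotated by `π/m`, where `m = 2ℓ`. -/
def midDiameters (ℓ : ℕ) : Set (Set ExtPlane) :=
  {l | ∃ i, l = join (toExt 0) (toExt (rotate (Real.pi / (2 * ℓ : ℕ)) (basePoint ℓ 0 i)))}

/-- The points of `D₄(ℓ)`: those of the celestial configuration, and the points at infinity in
the directions of the diameters and mid-diameters. -/
def points (ℓ : ℕ) : Set ExtPlane :=
  celestialPoints (basePoint ℓ) ∪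
    {x | x ∈ lineAtInfinity ∧ ∃ l ∈ diameters ℓ ∪ midDiameters ℓ, x ∈ l}

/-- The lines of `D₄(ℓ)`: those of the celestial configuration, the diameters and the
mid-diameters. -/
def lines (ℓ : ℕ) : Set (Set ExtPlane) :=
  celestialLines spanS (basePoint ℓ) ∪ diameters ℓ ∪ midDiameters ℓ

/-! ### Projection into the Euclidean plane, and pencils of parallel lines -/

/-- The projective transformation of the extended plane that is induced by `g`. -/
def transform (g : (Fin 3 → ℝ) ≃ₗ[ℝ] (Fin 3 → ℝ)) : ExtPlane → ExtPlane :=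
  Projectivization.map g.toLinearMap g.injective

/-- The projective transformation maps all points of `P` to finite points. -/
def IsSuitable (g : (Fin 3 → ℝ) ≃ₗ[ℝ] (Fin 3 → ℝ)) (P : Set ExtPlane) : Prop :=
  ∀ x ∈ P, transform g x ∉ lineAtInfinity

/-- The finite part of the image of a set under a projective transformation. -/
def project (g : (Fin 3 → ℝ) ≃ₗ[ℝ] (Fin 3 → ℝ)) (S : Set ExtPlane) : Set Plane :=
  toExt ⁻¹' (transform g '' S)

/-- Two lines are parallel (possibly equal) if they are translates of each other. -/
def Parallel (l l' : Set Plane) : Prop := ∃ w : Plane, l' = (fun x => x + w) '' l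

/-- Among the lines `L` there are a pencil of `p` parallel lines and a pencil of `q` parallel
lines, in different directions, that are independent: they share no configuration point. -/
def HasIndependentPencils (P : Set Plane) (L : Set (Set Plane)) (p q : ℕ) : Prop :=
  ∃ A ⊆ L, ∃ B ⊆ L, A.encard = p ∧ B.encard = q ∧
    (∀ l ∈ A, ∀ l' ∈ A, Parallel l l') ∧ (∀ l ∈ B, ∀ l' ∈ B, Parallel l l') ∧
    (∀ l ∈ A, ∀ l' ∈ B, ¬ Parallel l l') ∧
    (∀ x ∈ P, ∀ l ∈ A, ∀ l' ∈ B, ¬ (x ∈ l ∧ x ∈ l'))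

end D4Config

end

/-!
Measure angles in units of `π / m`. The line `(L_j)_i` has a normal in direction `n` and distance
`d` from the origin, and contains the point with polar coordinates `r`, `k` iff
`r * cos ((k - n) π / m) = d`. The four intended incidences hold by the choice of radii and offsets.
Accidental ones are impossible: for the symbol at hand the ratio `d / r` lies strictly between two
consecutive values of `cos (e π / m)` with `e` of the parity that can occur.

The offsets of the point classes and the normal directions of the line classes are each balanced
modulo `2`. Hence every diameter or mid-diameter contains two opposite points of each of two
classes, and every point at infinity lies on two parallel lines of each of two classes, which
raises `(8ℓ)_4` to `(10ℓ)_5`.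

Any two lines whose images meet in a finite point that is not a configuration point are
independent pencils of size one. Two diameters are such a pair unless the centre is sent to
infinity, and then a diameter and a line `(L_j)_i` perpendicular to it are one. Finally, if the
line sent to infinity avoids all intersection points of two lines, no two image lines are parallel.
-/

namespace D4Config

/-! ### Lines of the extended plane in homogeneous coordinates -/

/-- The line with equation `w 0 * x + w 1 * y + w 2 * z = 0`; all of the extended plane
if `w = 0`. -/
def lineOf (w : Fin 3 → ℝ) : Set ExtPlane := {x | x.rep ⬝ᵥ w = 0}

theorem mk_mem_lineOf {u : Fin 3 → ℝ} (hu : u ≠ 0) (w : Fin 3 → ℝ) :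
    Projectivization.mk ℝ u hu ∈ lineOf w ↔ u ⬝ᵥ w = 0 := by
  obtain ⟨a, ha⟩ := Projectivization.exists_smul_eq_mk_rep ℝ u hu
  rw [lineOf, Set.mem_ofPred_eq, ← ha, Units.smul_def, smul_dotProduct,
    smul_eq_zero_iff_right a.ne_zero]

theorem lineAtInfinity_eq_lineOf : lineAtInfinity = lineOf ![0, 0, 1] := by
  ext x
  simp [lineAtInfinity, lineOf, dotProduct, Fin.sum_univ_three]

theorem left_mem_join (a b : ExtPlane) : a ∈ join a b :=
  le_sup_left (a := a.submodule)

theorem right_mem_join (a b : ExtPlane) : b ∈ join a b :=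
  le_sup_right (b := b.submodule)

theorem join_eq_lineOf {a b : ExtPlane} (hab : a ≠ b) {w : Fin 3 → ℝ} (hw : w ≠ 0)
    (ha : a ∈ lineOf w) (hb : b ∈ lineOf w) : join a b = lineOf w := by
  set φ : Module.Dual ℝ (Fin 3 → ℝ) := (dotProductBilin ℝ ℝ).flip w
  have mem_iff (x : ExtPlane) : x ∈ lineOf w ↔ x.submodule ≤ LinearMap.ker φ := by
    rw [x.submodule_eq, Submodule.span_singleton_le_iff_mem]
    rfl
  have hφ : φ ≠ 0 := fun h ↦ hw (dotProduct_self_eq_zero.1 (LinearMap.congr_fun h w))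
  have finrank_ker := Module.Dual.finrank_ker_add_one_of_ne_zero hφ
  have finrank_sup : Module.finrank ℝ ↥(a.submodule ⊔ b.submodule) = 2 := by
    have h := finrank_span_eq_card (Projectivization.linearIndependent_pair_iff_ne.2 hab)
    rwa [Matrix.range_cons_cons_empty, Submodule.span_insert, ← a.submodule_eq,
      ← b.submodule_eq, Fintype.card_fin] at h
  have sup_eq_ker : a.submodule ⊔ b.submodule = LinearMap.ker φ := by
    refine Submodule.eq_of_le_of_finrank_le (sup_le ((mem_iff a).1 ha) ((mem_iff b).1 hb)) ?_
    rw [Module.finrank_fin_fun] at finrank_ker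
    omega
  ext x
  rw [mem_iff, ← sup_eq_ker, join, Set.mem_ofPred_eq]

theorem exists_ne_zero_dotProduct_eq_zero (u v : Fin 3 → ℝ) :
    ∃ w : Fin 3 → ℝ, w ≠ 0 ∧ u ⬝ᵥ w = 0 ∧ v ⬝ᵥ w = 0 := by
  set f : (Fin 3 → ℝ) →ₗ[ℝ] ℝ × ℝ :=
    (dotProductBilin ℝ ℝ u).prod (dotProductBilin ℝ ℝ v)
  have hf : LinearMap.ker f ≠ ⊥ := LinearMap.ker_ne_bot_of_finrank_lt (by simp)
  obtain ⟨w, hw, hw0⟩ := Submodule.exists_mem_ne_zero_of_ne_bot hf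
  have h := LinearMap.mem_ker.1 hw
  exact ⟨w, hw0, congrArg Prod.fst h, congrArg Prod.snd h⟩

theorem mem_extLines_iff {l : Set ExtPlane} : l ∈ extLines ↔ ∃ w, w ≠ 0 ∧ l = lineOf w := by
  constructor
  · rintro ⟨a, b, hab, rfl⟩
    obtain ⟨w, hw, ha, hb⟩ := exists_ne_zero_dotProduct_eq_zero a.rep b.rep
    exact ⟨w, hw, join_eq_lineOf hab hw ha hb⟩
  · rintro ⟨w, hw, rfl⟩
    obtain ⟨u, hu, huw, -⟩ := exists_ne_zero_dotProduct_eq_zero w w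
    obtain ⟨v, hv, hvw, hvu⟩ := exists_ne_zero_dotProduct_eq_zero w u
    have huv : Projectivization.mk ℝ u hu ≠ Projectivization.mk ℝ v hv := by
      intro h
      obtain ⟨c, rfl⟩ := (Projectivization.mk_eq_mk_iff' ℝ u v hu hv).1 h
      rw [smul_dotProduct, smul_eq_zero, dotProduct_self_eq_zero] at hvu
      rcases hvu with rfl | rfl
      · exact hu (zero_smul ℝ v)
      · exact hv rfl
    rw [dotProduct_comm] at huw hvw
    exact ⟨_, _, huv, (join_eq_lineOf huv hw ((mk_mem_lineOf hu w).2 huw)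
      ((mk_mem_lineOf hv w).2 hvw)).symm⟩

theorem lineAtInfinity_mem_extLines : lineAtInfinity ∈ extLines :=
  mem_extLines_iff.2 ⟨_, by simp, lineAtInfinity_eq_lineOf⟩

theorem eq_join_of_mem {l : Set ExtPlane} (hl : l ∈ extLines) {a b : ExtPlane} (hab : a ≠ b)
    (ha : a ∈ l) (hb : b ∈ l) : l = join a b := by
  obtain ⟨w, hw, rfl⟩ := mem_extLines_iff.1 hl
  exact (join_eq_lineOf hab hw ha hb).symm

theorem eq_of_mem_of_mem {l l' : Set ExtPlane} (hl : l ∈ extLines) (hl' : l' ∈ extLines)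
    {a b : ExtPlane} (hab : a ≠ b) (ha : a ∈ l) (hb : b ∈ l) (ha' : a ∈ l') (hb' : b ∈ l') :
    l = l' :=
  (eq_join_of_mem hl hab ha hb).trans (eq_join_of_mem hl' hab ha' hb').symm

theorem eq_of_mem_inter {l l' : Set ExtPlane} (hl : l ∈ extLines) (hl' : l' ∈ extLines)
    (hne : l ≠ l') {a b : ExtPlane} (ha : a ∈ l ∩ l') (hb : b ∈ l ∩ l') : a = b :=
  not_imp_comm.1 (eq_of_mem_of_mem hl hl' · ha.1 hb.1 ha.2 hb.2) hne

theorem inter_nonempty {l l' : Set ExtPlane} (hl : l ∈ extLines) (hl' : l' ∈ extLines) :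
    (l ∩ l').Nonempty := by
  obtain ⟨w, -, rfl⟩ := mem_extLines_iff.1 hl
  obtain ⟨w', -, rfl⟩ := mem_extLines_iff.1 hl'
  obtain ⟨u, hu, huw, huw'⟩ := exists_ne_zero_dotProduct_eq_zero w w'
  rw [dotProduct_comm] at huw huw'
  exact ⟨Projectivization.mk ℝ u hu, (mk_mem_lineOf hu w).2 huw, (mk_mem_lineOf hu w').2 huw'⟩

/-! ### The Euclidean plane inside the extended plane -/

theorem toExt_injective : Function.Injective toExt := by
  intro x y h
  obtain ⟨c, hc⟩ := (Projectivization.mk_eq_mk_iff' ℝ _ _ _ _).1 h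
  have h2 : c = 1 := by simpa using congrFun hc 2
  subst h2
  ext i
  fin_cases i
  · simpa using (congrFun hc 0).symm
  · simpa using (congrFun hc 1).symm

theorem toExt_mem_lineOf (x : Plane) (w : Fin 3 → ℝ) :
    toExt x ∈ lineOf w ↔ x 0 * w 0 + x 1 * w 1 + w 2 = 0 := by
  rw [toExt, mk_mem_lineOf]
  simp [dotProduct, Fin.sum_univ_three]

theorem toExt_notMem_lineAtInfinity (x : Plane) : toExt x ∉ lineAtInfinity := by
  rw [lineAtInfinity_eq_lineOf, toExt_mem_lineOf]
  simp

theorem exists_toExt_eq {x : ExtPlane} (hx : x ∉ lineAtInfinity) : ∃ y, toExt y = x := by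
  induction x using Projectivization.ind with
  | h u hu =>
    have hu2 : u 2 ≠ 0 := by
      simpa [lineAtInfinity_eq_lineOf, mk_mem_lineOf, dotProduct, Fin.sum_univ_three] using hx
    refine ⟨!₂[(u 2)⁻¹ * u 0, (u 2)⁻¹ * u 1],
      (Projectivization.mk_eq_mk_iff' ℝ _ _ _ _).2 ⟨(u 2)⁻¹, ?_⟩⟩
    ext i
    fin_cases i <;> simp [hu2]

theorem mk_mem_join_mk {x u v : Fin 3 → ℝ} (hx : x ≠ 0) (hu : u ≠ 0) (hv : v ≠ 0) :
    Projectivization.mk ℝ x hx ∈ join (Projectivization.mk ℝ u hu) (Projectivization.mk ℝ v hv) ↔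
      ∃ s t : ℝ, s • u + t • v = x := by
  rw [join, Set.mem_ofPred_eq, Projectivization.submodule_mk, Projectivization.submodule_mk,
    Projectivization.submodule_mk, Submodule.span_singleton_le_iff_mem, ← Submodule.span_insert,
    Submodule.mem_span_pair]

theorem toExt_mem_join_toExt {a b : Plane} (x : Plane) :
    toExt x ∈ join (toExt a) (toExt b) ↔ x ∈ affineSpan ℝ {a, b} := by
  rw [toExt, toExt, toExt, mk_mem_join_mk, mem_affineSpan_pair_iff_exists_lineMap_eq]
  constructor
  · rintro ⟨s, t, h⟩
    obtain rfl : s = 1 - t := eq_sub_of_add_eq (by simpa using congrFun h 2)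
    refine ⟨t, ?_⟩
    ext i
    fin_cases i
    · simpa [AffineMap.lineMap_apply_module] using congrFun h 0
    · simpa [AffineMap.lineMap_apply_module] using congrFun h 1
  · rintro ⟨t, rfl⟩
    refine ⟨1 - t, t, ?_⟩
    ext i
    fin_cases i <;> simp [AffineMap.lineMap_apply_module]

/-! ### Building configurations -/

theorem encard_sep_range {ι X : Type*} {f : ι → X} (hf : Function.Injective f) (p : X → Prop) :
    {x ∈ Set.range f | p x}.encard = {i | p (f i)}.encard := by
  rw [← hf.encard_image]
  congr 1
  ext x
  constructor
  · rintro ⟨⟨i, rfl⟩, hi⟩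
    exact ⟨i, hi, rfl⟩
  · rintro ⟨i, hi, rfl⟩
    exact ⟨⟨i, rfl⟩, hi⟩

theorem encard_range {ι X : Type*} [Finite ι] {f : ι → X} (hf : Function.Injective f) :
    (Set.range f).encard = Nat.card ι := by
  rw [← Set.image_univ, hf.encard_image, Set.encard_univ, ENat.card_eq_coe_natCard]

theorem isConfiguration_range {X : Type} {I J : Type*} [Finite I] [Finite J]
    {lines : Set (Set X)} {n k : ℕ} {p : I → X} {l : J → Set X}
    (hl : ∀ j, l j ∈ lines) (hp : Function.Injective p) (hinj : Function.Injective l)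
    (hI : Nat.card I = n) (hJ : Nat.card J = n)
    (hIk : ∀ j, {i | p i ∈ l j}.encard = k) (hJk : ∀ i, {j | p i ∈ l j}.encard = k) :
    IsConfiguration lines n k (Set.range p) (Set.range l) where
  isLine := Set.range_subset_iff.2 hl
  card_points := by rw [encard_range hp, hI]
  card_lines := by rw [encard_range hinj, hJ]
  points_on_line := by
    rintro _ ⟨j, rfl⟩
    rw [encard_sep_range hp, hIk]
  lines_through_point := by
    rintro _ ⟨i, rfl⟩
    rw [encard_sep_range hinj, hJk]

theorem encard_sep_union {X : Type*} {s t : Set X} (hst : Disjoint s t) (p : X → Prop) :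
    {x ∈ s ∪ t | p x}.encard = {x ∈ s | p x}.encard + {x ∈ t | p x}.encard := by
  rw [← Set.encard_union_eq (hst.mono (Set.sep_subset s p) (Set.sep_subset t p))]
  congr 1
  ext x
  exact or_and_right

theorem IsConfiguration.union {X : Type} {lines : Set (Set X)} {n n' k k' : ℕ} {P Q : Set X}
    {L M : Set (Set X)} (h : IsConfiguration lines n k P L) (h' : IsConfiguration lines n' k' Q M)
    (hPQ : Disjoint P Q) (hLM : Disjoint L M)
    (hLQ : ∀ l ∈ L, {q ∈ Q | q ∈ l}.encard = k') (hMP : ∀ l ∈ M, {p ∈ P | p ∈ l}.encard = k)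
    (hPM : ∀ p ∈ P, {l ∈ M | p ∈ l}.encard = k') (hQL : ∀ q ∈ Q, {l ∈ L | q ∈ l}.encard = k) :
    IsConfiguration lines (n + n') (k + k') (P ∪ Q) (L ∪ M) where
  isLine := Set.union_subset h.isLine h'.isLine
  card_points := by
    rw [Set.encard_union_eq hPQ, h.card_points, h'.card_points, Nat.cast_add]
  card_lines := by
    rw [Set.encard_union_eq hLM, h.card_lines, h'.card_lines, Nat.cast_add]
  points_on_line := by
    rintro l (hl | hl)
    · rw [encard_sep_union hPQ, h.points_on_line l hl, hLQ l hl, Nat.cast_add]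
    · rw [encard_sep_union hPQ, hMP l hl, h'.points_on_line l hl, Nat.cast_add]
  lines_through_point := by
    rintro p (hp | hp)
    · rw [encard_sep_union hLM, h.lines_through_point p hp, hPM p hp, Nat.cast_add]
    · rw [encard_sep_union hLM, hQL p hp, h'.lines_through_point p hp, Nat.cast_add]

/-! ### Projective images of configurations -/

section Transform

variable {g : (Fin 3 → ℝ) ≃ₗ[ℝ] (Fin 3 → ℝ)}

theorem transform_injective : Function.Injective (transform g) :=
  Projectivization.map_injective _ g.injective

theorem transform_surjective : Function.Surjective (transform g) := by
  intro y
  induction y using Projectivization.ind with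
  | h u hu =>
    refine ⟨Projectivization.mk ℝ (g.symm u) (g.symm.map_ne_zero_iff.2 hu), ?_⟩
    simp [transform, Projectivization.map_mk]

theorem transform_mem_lineAtInfinity {u : Fin 3 → ℝ} (hu : u ≠ 0) :
    transform g (Projectivization.mk ℝ u hu) ∈ lineAtInfinity ↔ g u 2 = 0 := by
  rw [transform, Projectivization.map_mk, lineAtInfinity_eq_lineOf, mk_mem_lineOf]
  simp [dotProduct, Fin.sum_univ_three]

theorem submodule_transform (x : ExtPlane) :
    (transform g x).submodule = x.submodule.map g.toLinearMap := by
  induction x using Projectivization.ind with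
  | h u hu =>
    rw [transform, Projectivization.map_mk, Projectivization.submodule_mk,
      Projectivization.submodule_mk, Submodule.map_span, Set.image_singleton]

theorem transform_mem_join {a b x : ExtPlane} :
    transform g x ∈ join (transform g a) (transform g b) ↔ x ∈ join a b := by
  rw [join, Set.mem_ofPred_eq, submodule_transform, submodule_transform, submodule_transform,
    ← Submodule.map_sup, Submodule.map_le_map_iff_of_injective g.injective, join,
    Set.mem_ofPred_eq]

theorem mem_project {S : Set ExtPlane} {x : Plane} {y : ExtPlane} (h : toExt x = transform g y) :
    x ∈ project g S ↔ y ∈ S := by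
  rw [project, Set.mem_preimage, h, transform_injective.mem_set_image]

theorem encard_project {S : Set ExtPlane} (hS : IsSuitable g S) :
    (project g S).encard = S.encard := by
  rw [← transform_injective.encard_image S, ← toExt_injective.encard_image, project,
    Set.image_preimage_eq_of_subset]
  rintro _ ⟨x, hx, rfl⟩
  exact exists_toExt_eq (hS x hx)

theorem project_join {a b : ExtPlane} {x y : Plane} (hx : toExt x = transform g a)
    (hy : toExt y = transform g b) :
    project g (join a b) = (affineSpan ℝ {x, y} : Set Plane) := by
  ext z
  rw [SetLike.mem_coe, ← toExt_mem_join_toExt, hx, hy]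
  constructor
  · rintro ⟨c, hc, hcz⟩
    rwa [← hcz, transform_mem_join]
  · intro hz
    obtain ⟨c, hc⟩ := transform_surjective (g := g) (toExt z)
    rw [← hc, transform_mem_join] at hz
    exact ⟨c, hz, hc⟩

theorem mem_lineAtInfinity_of_mem_join {a b x : ExtPlane} (hab : a ≠ b)
    (ha : transform g a ∈ lineAtInfinity) (hb : transform g b ∈ lineAtInfinity)
    (hx : x ∈ join a b) : transform g x ∈ lineAtInfinity := by
  rw [eq_join_of_mem lineAtInfinity_mem_extLines (transform_injective.ne hab) ha hb]
  exact transform_mem_join.2 hx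

theorem Parallel.eq_of_mem {l l' : Set Plane} (hl : l ∈ planeLines) (h : Parallel l l')
    {x : Plane} (hx : x ∈ l) (hx' : x ∈ l') : l = l' := by
  obtain ⟨a, b, -, rfl⟩ := hl
  obtain ⟨w, rfl⟩ := h
  obtain ⟨y, hy, rfl⟩ := hx'
  have hw : w ∈ (affineSpan ℝ {a, b}).direction := by
    simpa using AffineSubspace.vsub_mem_direction hx hy
  ext z
  rw [Set.image_add_right, Set.mem_preimage, SetLike.mem_coe, SetLike.mem_coe, add_comm,
    ← vadd_eq_add, AffineSubspace.vadd_mem_iff_mem_of_mem_direction (neg_mem hw)]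

end Transform

namespace IsConfiguration

variable {n k : ℕ} {P : Set ExtPlane} {L : Set (Set ExtPlane)}
  {g : (Fin 3 → ℝ) ≃ₗ[ℝ] (Fin 3 → ℝ)}

theorem exists_eq_join (h : IsConfiguration extLines n k P L) (hk : 2 ≤ k) {l : Set ExtPlane}
    (hl : l ∈ L) : ∃ a ∈ P, ∃ b ∈ P, a ≠ b ∧ l = join a b := by
  have one_lt : 1 < {p ∈ P | p ∈ l}.encard := by
    rw [h.points_on_line l hl]
    exact_mod_cast hk
  obtain ⟨a, b, ⟨ha, hal⟩, ⟨hb, hbl⟩, hab⟩ := Set.one_lt_encard_iff.1 one_lt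
  exact ⟨a, ha, b, hb, hab, eq_join_of_mem (h.isLine hl) hab hal hbl⟩

theorem project_injOn (h : IsConfiguration extLines n k P L) (hk : 2 ≤ k)
    (hg : IsSuitable g P) : Set.InjOn (project g) L := by
  intro l hl l' hl' heq
  obtain ⟨a, ha, b, hb, hab, rfl⟩ := h.exists_eq_join hk hl
  obtain ⟨x, hx⟩ := exists_toExt_eq (hg a ha)
  obtain ⟨y, hy⟩ := exists_toExt_eq (hg b hb)
  have hal' : a ∈ l' := by rw [← mem_project hx, ← heq, mem_project hx]; exact left_mem_join a b
  have hbl' : b ∈ l' := by rw [← mem_project hy, ← heq, mem_project hy]; exact right_mem_join a b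
  exact (eq_join_of_mem (h.isLine hl') hab hal' hbl').symm

theorem project_mem_planeLines (h : IsConfiguration extLines n k P L) (hk : 2 ≤ k)
    (hg : IsSuitable g P) {l : Set ExtPlane} (hl : l ∈ L) : project g l ∈ planeLines := by
  obtain ⟨a, ha, b, hb, hab, rfl⟩ := h.exists_eq_join hk hl
  obtain ⟨x, hx⟩ := exists_toExt_eq (hg a ha)
  obtain ⟨y, hy⟩ := exists_toExt_eq (hg b hb)
  refine ⟨x, y, ?_, project_join hx hy⟩
  rintro rfl
  exact hab (transform_injective (hx.symm.trans hy))

theorem image_project (h : IsConfiguration extLines n k P L) (hk : 2 ≤ k)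
    (hg : IsSuitable g P) : IsConfiguration planeLines n k (project g P) (project g '' L) where
  isLine := by
    rintro _ ⟨l, hl, rfl⟩
    exact h.project_mem_planeLines hk hg hl
  card_points := by rw [encard_project hg, h.card_points]
  card_lines := by rw [(h.project_injOn hk hg).encard_image, h.card_lines]
  points_on_line := by
    rintro _ ⟨l, hl, rfl⟩
    rw [← h.points_on_line l hl, ← encard_project fun x hx ↦ hg x hx.1]
    congr 1
    ext x
    constructor
    · rintro ⟨⟨p, hp, hpx⟩, hxl⟩
      exact ⟨p, ⟨hp, (mem_project hpx.symm).1 hxl⟩, hpx⟩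
    · rintro ⟨p, hp, hpx⟩
      exact ⟨⟨p, hp.1, hpx⟩, (mem_project hpx.symm).2 hp.2⟩
  lines_through_point := by
    rintro x ⟨p, hp, hpx⟩
    rw [← h.lines_through_point p hp,
      ← ((h.project_injOn hk hg).mono (Set.sep_subset L _)).encard_image]
    congr 1
    ext l
    constructor
    · rintro ⟨⟨l, hl, rfl⟩, hxl⟩
      exact ⟨l, ⟨hl, (mem_project hpx.symm).1 hxl⟩, rfl⟩
    · rintro ⟨l, hl, rfl⟩
      exact ⟨⟨l, hl.1, rfl⟩, (mem_project hpx.symm).2 hl.2⟩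

theorem eq_of_parallel (h : IsConfiguration extLines n k P L) (hk : 2 ≤ k)
    (hg : IsSuitable g P) {l l' : Set ExtPlane} (hl : l ∈ L) (hl' : l' ∈ L)
    (hpar : Parallel (project g l) (project g l')) {x : ExtPlane} (hx : x ∈ l ∩ l')
    (hfin : transform g x ∉ lineAtInfinity) : l = l' := by
  obtain ⟨y, hy⟩ := exists_toExt_eq hfin
  exact h.project_injOn hk hg hl hl' (hpar.eq_of_mem (h.project_mem_planeLines hk hg hl)
    ((mem_project hy).2 hx.1) ((mem_project hy).2 hx.2))

theorem hasIndependentPencils_of_mem_inter (h : IsConfiguration extLines n k P L) (hk : 2 ≤ k)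
    (hg : IsSuitable g P) {l l' : Set ExtPlane} (hl : l ∈ L) (hl' : l' ∈ L) (hne : l ≠ l')
    {x : ExtPlane} (hx : x ∈ l ∩ l') (hfin : transform g x ∉ lineAtInfinity)
    (hP : Disjoint P (l ∩ l')) :
    HasIndependentPencils (project g P) (project g '' L) 1 1 := by
  have parallel_refl (l : Set Plane) : Parallel l l := ⟨0, by simp⟩
  refine ⟨{project g l}, by simpa using ⟨l, hl, rfl⟩, {project g l'},
    by simpa using ⟨l', hl', rfl⟩, by simp, by simp, ?_, ?_, ?_, ?_⟩
  · rintro _ rfl _ rfl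
    exact parallel_refl _
  · rintro _ rfl _ rfl
    exact parallel_refl _
  · rintro _ rfl _ rfl hpar
    exact hne (h.eq_of_parallel hk hg hl hl' hpar hx hfin)
  · rintro y ⟨p, hp, hpy⟩ _ rfl _ rfl ⟨hyl, hyl'⟩
    exact Set.disjoint_left.1 hP hp
      ⟨(mem_project hpy.symm).1 hyl, (mem_project hpy.symm).1 hyl'⟩

/- If `o` stays finite, take the lines `a` and `b`. Otherwise `o` is the only point of `a` at
infinity, since `a` carries points of `P`; then `a` meets `c` in a finite point. -/
theorem hasIndependentPencils_one_one (h : IsConfiguration extLines n k P L) (hk : 2 ≤ k)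
    (hg : IsSuitable g P) {a b c : Set ExtPlane} (ha : a ∈ L) (hb : b ∈ L) (hc : c ∈ L)
    (hne : a ≠ b) {o : ExtPlane} (hoa : o ∈ a) (hob : o ∈ b) (hoc : o ∉ c)
    (hab : Disjoint P (a ∩ b)) (hac : Disjoint P (a ∩ c)) :
    HasIndependentPencils (project g P) (project g '' L) 1 1 := by
  by_cases ho : transform g o ∈ lineAtInfinity
  · obtain ⟨x, hx⟩ := inter_nonempty (h.isLine ha) (h.isLine hc)
    have hox : o ≠ x := by rintro rfl; exact hoc hx.2
    obtain ⟨p, hp, q, -, -, rfl⟩ := h.exists_eq_join hk ha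
    have hfin : transform g x ∉ lineAtInfinity := by
      intro hinf
      refine hg p hp (mem_lineAtInfinity_of_mem_join hox ho hinf ?_)
      rw [← eq_join_of_mem (h.isLine ha) hox hoa hx.1]
      exact left_mem_join p q
    exact h.hasIndependentPencils_of_mem_inter hk hg ha hc (by rintro rfl; exact hoc hoa) hx hfin
      hac
  · exact h.hasIndependentPencils_of_mem_inter hk hg ha hb hne ⟨hoa, hob⟩ ho hab

end IsConfiguration

/-! ### Sending finitely many points to finite points -/

/-- A projective transformation that maps the line with equation `x + t y + t² z = 0` to
infinity. As `t` varies these lines form a dual conic, so that a point lies on at most two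
of them. -/
def shear (t : ℝ) : (Fin 3 → ℝ) ≃ₗ[ℝ] (Fin 3 → ℝ) where
  toFun v := ![v 1, v 2, v 0 + t * v 1 + t ^ 2 * v 2]
  invFun v := ![v 2 - t * v 0 - t ^ 2 * v 1, v 0, v 1]
  map_add' u v := by
    ext i
    fin_cases i
    · simp
    · simp
    · simp; ring
  map_smul' c v := by
    ext i
    fin_cases i
    · simp
    · simp
    · simp; ring
  left_inv v := by
    ext i
    fin_cases i
    · simp; ring
    · simp
    · simp
  right_inv v := by
    ext i
    fin_cases i
    · simp
    · simp
    · simp; ring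

theorem finite_setOf_transform_shear_mem_lineAtInfinity (x : ExtPlane) :
    {t : ℝ | transform (shear t) x ∈ lineAtInfinity}.Finite := by
  induction x using Projectivization.ind with
  | h u hu =>
    set f : Polynomial ℝ := Polynomial.ofFn 3 u
    have hf : f ≠ 0 := fun h ↦ hu (Polynomial.injective_ofFn 3 (h.trans (map_zero _).symm))
    refine (f.rootSet_finite ℝ).subset fun t ht ↦ ?_
    rw [Set.mem_ofPred_eq, transform_mem_lineAtInfinity] at ht
    have hroot : f.eval t = u 0 + t * u 1 + t ^ 2 * u 2 := by
      rw [Polynomial.eval_eq_sum_range' (Polynomial.ofFn_natDegree_lt (by norm_num) u)]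
      simp [Finset.sum_range_succ, mul_comm]
    rw [Polynomial.mem_rootSet, Polynomial.coe_aeval_eq_eval, hroot]
    exact ⟨hf, ht⟩

theorem exists_isSuitable {S : Set ExtPlane} (hS : S.Finite) : ∃ g, IsSuitable g S := by
  obtain ⟨t, ht⟩ := (hS.biUnion fun x _ ↦
    finite_setOf_transform_shear_mem_lineAtInfinity x).infinite_compl.nonempty
  exact ⟨shear t, fun x hx h ↦ ht (Set.mem_biUnion hx h)⟩

namespace IsConfiguration

variable {n k : ℕ} {P : Set ExtPlane} {L : Set (Set ExtPlane)}

theorem encard_le_one_of_parallel {g : (Fin 3 → ℝ) ≃ₗ[ℝ] (Fin 3 → ℝ)}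
    (h : IsConfiguration extLines n k P L) (hk : 2 ≤ k) (hg : IsSuitable g P)
    (hinter : ∀ l ∈ L, ∀ l' ∈ L, ∃ x ∈ l ∩ l', transform g x ∉ lineAtInfinity)
    {A : Set (Set Plane)} (hA : A ⊆ project g '' L) (hpar : ∀ l ∈ A, ∀ l' ∈ A, Parallel l l') :
    A.encard ≤ 1 := by
  rw [Set.encard_le_one_iff]
  intro a b ha hb
  have hab := hpar a ha b hb
  obtain ⟨l, hl, rfl⟩ := hA ha
  obtain ⟨l', hl', rfl⟩ := hA hb
  obtain ⟨x, hx, hfin⟩ := hinter l hl l' hl'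
  rw [h.eq_of_parallel hk hg hl hl' hab hx hfin]

theorem exists_isSuitable_pencils_le_one (h : IsConfiguration extLines n k P L) (hk : 2 ≤ k) :
    ∃ g, IsSuitable g P ∧ ∀ p q : ℕ, HasIndependentPencils (project g P) (project g '' L) p q →
      p ≤ 1 ∧ q ≤ 1 := by
  choose! f hf using fun (l : Set ExtPlane) (hl : l ∈ extLines) (l' : Set ExtPlane)
    (hl' : l' ∈ extLines) ↦ inter_nonempty hl hl'
  have hP : P.Finite := Set.finite_of_encard_eq_coe h.card_points
  have hL : L.Finite := Set.finite_of_encard_eq_coe h.card_lines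
  obtain ⟨g, hg⟩ := exists_isSuitable (hP.union (hL.image2 f hL))
  have hgP : IsSuitable g P := fun x hx ↦ hg x (Or.inl hx)
  have hinter (l) (hl : l ∈ L) (l') (hl' : l' ∈ L) :
      ∃ x ∈ l ∩ l', transform g x ∉ lineAtInfinity :=
    ⟨f l l', hf l (h.isLine hl) l' (h.isLine hl'), hg _ (Or.inr ⟨l, hl, l', hl', rfl⟩)⟩
  refine ⟨g, hgP, ?_⟩
  rintro p q ⟨A, hA, B, hB, hp, hq, hAp, hBp, -, -⟩
  have hpA := h.encard_le_one_of_parallel hk hgP hinter hA hAp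
  have hqB := h.encard_le_one_of_parallel hk hgP hinter hB hBp
  rw [hp] at hpA
  rw [hq] at hqB
  exact ⟨by exact_mod_cast hpA, by exact_mod_cast hqB⟩

end IsConfiguration

/-! ### Sines and cosines of multiples of `π / m` -/

noncomputable section

/-- The cosine of `k π / m`. -/
def cosMul (m : ℕ) (k : ℤ) : ℝ := Real.cos (k * (Real.pi / m))

/-- The sine of `k π / m`. -/
def sinMul (m : ℕ) (k : ℤ) : ℝ := Real.sin (k * (Real.pi / m))

end

section Trig

variable {m : ℕ}

@[simp] theorem cosMul_zero : cosMul m 0 = 1 := by simp [cosMul]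

@[simp] theorem cosMul_neg (k : ℤ) : cosMul m (-k) = cosMul m k := by simp [cosMul]

theorem cosMul_add (k n : ℤ) :
    cosMul m (k + n) = cosMul m k * cosMul m n - sinMul m k * sinMul m n := by
  simp only [cosMul, sinMul, Int.cast_add, add_mul, Real.cos_add]

theorem cosMul_sub (k n : ℤ) :
    cosMul m (k - n) = cosMul m k * cosMul m n + sinMul m k * sinMul m n := by
  simp only [cosMul, sinMul, Int.cast_sub, sub_mul, Real.cos_sub]

theorem sinMul_add (k n : ℤ) :
    sinMul m (k + n) = sinMul m k * cosMul m n + cosMul m k * sinMul m n := by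
  simp only [cosMul, sinMul, Int.cast_add, add_mul, Real.sin_add]

theorem sinMul_sub (k n : ℤ) :
    sinMul m (k - n) = sinMul m k * cosMul m n - cosMul m k * sinMul m n := by
  simp only [cosMul, sinMul, Int.cast_sub, sub_mul, Real.sin_sub]

theorem cosMul_sq_add_sinMul_sq (k : ℤ) : cosMul m k ^ 2 + sinMul m k ^ 2 = 1 :=
  Real.cos_sq_add_sin_sq _

theorem two_mul_cosMul_mul_cosMul (p q : ℤ) :
    2 * (cosMul m p * cosMul m q) = cosMul m (p + q) + cosMul m (p - q) := by
  rw [cosMul_add, cosMul_sub]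
  ring

variable (hm : 0 < m)
include hm

theorem coe_angle_eq_iff (e k : ℤ) :
    ((e * (Real.pi / m) : ℝ) : Real.Angle) = (k * (Real.pi / m) : ℝ) ↔ e ≡ k [ZMOD 2 * m] := by
  rw [Real.Angle.angle_eq_iff_two_pi_dvd_sub, Int.modEq_comm, Int.modEq_iff_dvd]
  refine exists_congr fun c ↦ ?_
  rw [← Int.cast_inj (α := ℝ)]
  push_cast
  field_simp

theorem cosMul_eq_iff (e k : ℤ) :
    cosMul m e = cosMul m k ↔ e ≡ k [ZMOD 2 * m] ∨ e ≡ -k [ZMOD 2 * m] := by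
  rw [cosMul, cosMul, ← Real.Angle.cos_coe, Real.Angle.cos_eq_real_cos_iff_eq_or_eq_neg,
    ← coe_angle_eq_iff hm, ← coe_angle_eq_iff hm, Int.cast_neg, neg_mul, Real.Angle.coe_neg]

theorem cosMul_sinMul_eq_iff (e k : ℤ) :
    cosMul m e = cosMul m k ∧ sinMul m e = sinMul m k ↔ e ≡ k [ZMOD 2 * m] := by
  rw [← coe_angle_eq_iff hm]
  constructor
  · rintro ⟨hcos, hsin⟩
    exact Real.Angle.cos_sin_inj hcos hsin
  · intro h
    exact ⟨congrArg Real.Angle.cos h, congrArg Real.Angle.sin h⟩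

theorem sinMul_sub_eq_zero_iff (k n : ℤ) : sinMul m (k - n) = 0 ↔ k ≡ n [ZMOD m] := by
  rw [sinMul, Real.sin_eq_zero_iff, Int.modEq_comm, Int.modEq_iff_dvd]
  refine exists_congr fun c ↦ ?_
  rw [← Int.cast_inj (α := ℝ)]
  push_cast
  field_simp
  exact eq_comm

theorem cosMul_two_mul_eq_zero_iff (e : ℤ) :
    cosMul (2 * m) e = 0 ↔ e ≡ m [ZMOD (2 * m : ℕ)] := by
  have half_turn : (m : ℤ) * (Real.pi / (2 * m : ℕ)) = Real.pi / 2 := by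
    push_cast
    field_simp
  have hcos : cosMul (2 * m) m = 0 := by rw [cosMul, half_turn, Real.cos_pi_div_two]
  have hsin : sinMul (2 * m) m = 1 := by rw [sinMul, half_turn, Real.sin_pi_div_two]
  rw [← sinMul_sub_eq_zero_iff (by positivity), sinMul_sub, hcos, hsin, mul_zero, zero_sub,
    mul_one, neg_eq_zero]

theorem cosMul_lt {p q : ℤ} (hp : 0 ≤ p) (hpq : p < q) (hq : q ≤ m) :
    cosMul m q < cosMul m p := by
  have hα : 0 < Real.pi / m := by positivity
  have hqm : (q : ℝ) * (Real.pi / m) ≤ Real.pi := by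
    rw [mul_div_left_comm]
    exact mul_le_of_le_one_right Real.pi_pos.le
      ((div_le_one (by exact_mod_cast hm)).2 (by exact_mod_cast hq))
  exact Real.cos_lt_cos_of_nonneg_of_le_pi (mul_nonneg (by exact_mod_cast hp) hα.le) hqm
    ((mul_lt_mul_iff_left₀ hα).2 (by exact_mod_cast hpq))

theorem cosMul_le {p q : ℤ} (hp : 0 ≤ p) (hpq : p ≤ q) (hq : q ≤ m) :
    cosMul m q ≤ cosMul m p := by
  rcases hpq.eq_or_lt with rfl | h
  · rfl
  · exact (cosMul_lt hm hp h hq).le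

theorem cosMul_pos {p : ℤ} (hp : 0 ≤ p) (hpm : 2 * p < m) : 0 < cosMul m p := by
  have hpm' : 2 * (p : ℝ) < m := by exact_mod_cast hpm
  refine Real.cos_pos_of_mem_Ioo ⟨?_, ?_⟩
  · have : 0 ≤ p * (Real.pi / m) := mul_nonneg (by exact_mod_cast hp) (by positivity)
    linarith [Real.pi_pos]
  · rw [← mul_div_assoc, div_lt_div_iff₀ (by positivity) two_pos]
    nlinarith [Real.pi_pos]

/- From `2 c p * c q = c (p + q) + c (p - q)`. -/
theorem cosMul_mul_cosMul_lt {p q p' q' : ℤ} (hadd : p' + q' ≤ p + q) (hsub : p' - q' ≤ p - q)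
    (hne : p' + q' < p + q ∨ p' - q' < p - q) (hadd_nonneg : 0 ≤ p' + q')
    (hsub_nonneg : 0 ≤ p' - q') (hpq : p + q ≤ m) (hpq' : p - q ≤ m) :
    cosMul m p * cosMul m q < cosMul m p' * cosMul m q' := by
  have h := two_mul_cosMul_mul_cosMul (m := m) p q
  have h' := two_mul_cosMul_mul_cosMul (m := m) p' q'
  rcases hne with hlt | hlt
  · have := cosMul_lt hm hadd_nonneg hlt hpq
    have := cosMul_le hm hsub_nonneg hsub hpq'
    linarith
  · have := cosMul_le hm hadd_nonneg hadd hpq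
    have := cosMul_lt hm hsub_nonneg hlt hpq'
    linarith

theorem exists_cosMul_eq (e : ℤ) :
    ∃ f : ℤ, 0 ≤ f ∧ f ≤ m ∧ f ≡ e [ZMOD 2] ∧ cosMul m f = cosMul m e := by
  have hM : (0 : ℤ) < 2 * m := by positivity
  have hnonneg := Int.emod_nonneg e hM.ne'
  have hlt := Int.emod_lt_of_pos e hM
  have hmod : e % (2 * m) ≡ e [ZMOD 2 * m] := Int.mod_modEq e _
  have hmod2 := hmod.of_mul_right (m : ℤ)
  rcases le_total (e % (2 * m)) m with hle | hle
  · exact ⟨_, hnonneg, hle, hmod2, (cosMul_eq_iff hm _ _).2 (Or.inl hmod)⟩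
  · refine ⟨2 * m - e % (2 * m), by lia, by lia, ?_, (cosMul_eq_iff hm _ _).2 (Or.inr ?_)⟩
    · rw [Int.modEq_iff_dvd] at hmod2 ⊢
      lia
    · simpa using (Int.modEq_zero_iff_dvd.2 (dvd_refl (2 * m : ℤ))).sub hmod

theorem cosMul_le_or_le (e : ℤ) {k : ℤ} (hk : 0 ≤ k) (hkm : k + 2 ≤ m) (hek : e ≡ k [ZMOD 2]) :
    cosMul m e ≤ cosMul m (k + 2) ∨ cosMul m k ≤ cosMul m e := by
  obtain ⟨f, hf0, hfm, hfe, hf⟩ := exists_cosMul_eq hm e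
  have hfk := hfe.trans hek
  rw [Int.modEq_iff_dvd] at hfk
  rw [← hf]
  rcases le_or_gt f k with hle | hlt
  · exact Or.inr (cosMul_le hm hf0 hle (by lia))
  · exact Or.inl (cosMul_le hm (by lia) (by lia) hfm)

theorem cosMul_le_of_modEq {e k : ℤ} (hk : 0 ≤ k) (hk1 : k ≤ 1) (hek : e ≡ k [ZMOD 2]) :
    cosMul m e ≤ cosMul m k := by
  obtain ⟨f, hf0, hfm, hfe, hf⟩ := exists_cosMul_eq hm e
  have hfk := hfe.trans hek
  rw [Int.modEq_iff_dvd] at hfk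
  rw [← hf]
  exact cosMul_le hm hk (by lia) hfm

theorem cosMul_mul_ne {A B : ℝ} (hA : 0 < A) {e k : ℤ} (hk : 0 ≤ k) (hkm : k + 2 ≤ m)
    (hek : e ≡ k [ZMOD 2]) (hlow : cosMul m (k + 2) * A < B) (hhigh : B < cosMul m k * A) :
    cosMul m e * A ≠ B := by
  rcases cosMul_le_or_le hm e hk hkm hek with h | h
  · exact ((mul_le_mul_of_nonneg_right h hA.le).trans_lt hlow).ne
  · exact (hhigh.trans_le (mul_le_mul_of_nonneg_right h hA.le)).ne'

theorem cosMul_mul_cosMul_ne {e k q a b : ℤ} (hq : 0 < cosMul m q) (hk : 0 ≤ k)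
    (hek : e ≡ k [ZMOD 2]) (hkq : 0 ≤ k + q) (hkq' : 0 ≤ k - q)
    (hadd : k + q ≤ a + b) (hsub : k - q ≤ a - b) (hne : k + q < a + b ∨ k - q < a - b)
    (hadd' : a + b ≤ k + 2 + q) (hsub' : a - b ≤ k + 2 - q)
    (hne' : a + b < k + 2 + q ∨ a - b < k + 2 - q) (hm1 : k + 2 + q ≤ m) (hm2 : k + 2 - q ≤ m) :
    cosMul m e * cosMul m q ≠ cosMul m a * cosMul m b := by
  refine cosMul_mul_ne hm hq hk (by omega) hek ?_ ?_ <;>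
    apply cosMul_mul_cosMul_lt hm <;> omega

end Trig

/-! ### The combinatorics of celestial configurations -/

theorem finRotate_ne_self {h : ℕ} (hh : 2 ≤ h) (j : Fin h) : finRotate h j ≠ j := by
  rw [← Equiv.Perm.mem_support, support_finRotate_of_le hh]
  exact Finset.mem_univ j

theorem finRotate_finRotate_ne_self {h : ℕ} (hh : 3 ≤ h) (j : Fin h) :
    finRotate h (finRotate h j) ≠ j := by
  obtain ⟨n, rfl⟩ : ∃ n, h = n + 1 := ⟨h - 1, by omega⟩
  simp only [ne_eq, Fin.ext_iff, coe_finRotate, Fin.val_last]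
  split_ifs <;> omega

theorem encard_setOf_mem_list {X : Type*} {l : List X} (hl : l.Nodup) :
    {x | x ∈ l}.encard = l.length := by
  classical
  rw [← List.toFinset_card_of_nodup hl, ← Set.encard_coe_eq_coe_finsetCard, List.coe_toFinset]

theorem zmod_cast_modEq {m : ℕ} (i : ℤ) : ((i : ZMod m).cast : ℤ) ≡ i [ZMOD m] := by
  rw [← ZMod.intCast_eq_intCast_iff, ZMod.intCast_zmod_cast]

section Incidence

variable {h : ℕ}

/-- The points `(v_j)_i` in the extended plane, indexed by residues modulo `m`. -/
noncomputable def celestialPointMod (m : ℕ) (v : Fin h → ℤ → Plane) (x : Fin h × ZMod m) :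
    ExtPlane :=
  toExt (v x.1 x.2.cast)

/-- The lines `(L_j)_i`, indexed by residues modulo `m`. -/
def celestialLineMod (m : ℕ) (s : Fin h → ℕ) (v : Fin h → ℤ → Plane) (x : Fin h × ZMod m) :
    Set ExtPlane :=
  celestialLine s v x.1 x.2.cast

variable {m : ℕ} {s t : Fin h → ℕ} {δ : Fin h → ℤ} {v : Fin h → ℤ → Plane}

section Points

variable (heq : ∀ j j' i i', v j i = v j' i' ↔ j = j' ∧ i ≡ i' [ZMOD m])
include heq

theorem celestialPointMod_injective : Function.Injective (celestialPointMod m v) := by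
  rintro ⟨j, i⟩ ⟨j', i'⟩ hxy
  obtain ⟨rfl, hi⟩ := (heq _ _ _ _).1 (toExt_injective hxy)
  rw [← ZMod.intCast_eq_intCast_iff, ZMod.intCast_zmod_cast, ZMod.intCast_zmod_cast] at hi
  exact Prod.ext rfl hi

theorem range_celestialPointMod : Set.range (celestialPointMod m v) = celestialPoints v := by
  ext x
  constructor
  · rintro ⟨⟨j, i⟩, rfl⟩
    exact ⟨j, _, rfl⟩
  · rintro ⟨j, i, rfl⟩
    exact ⟨(j, i), congrArg toExt ((heq _ _ _ _).2 ⟨rfl, zmod_cast_modEq i⟩)⟩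

theorem range_celestialLineMod :
    Set.range (celestialLineMod m s v) = celestialLines s v := by
  ext l
  constructor
  · rintro ⟨⟨j, i⟩, rfl⟩
    exact ⟨j, _, rfl⟩
  · rintro ⟨j, i, rfl⟩
    refine ⟨(j, i), ?_⟩
    rw [celestialLineMod, celestialLine, celestialLine,
      (heq j j _ i).2 ⟨rfl, zmod_cast_modEq i⟩,
      (heq j j _ (i + s j)).2 ⟨rfl, (zmod_cast_modEq i).add_right _⟩]

end Points

variable (hmem : ∀ a k j i, toExt (v a k) ∈ celestialLine s v j i ↔
    (a = j ∧ (k ≡ i [ZMOD m] ∨ k ≡ i + s j [ZMOD m])) ∨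
    (a = finRotate h j ∧ (k ≡ i + δ j [ZMOD m] ∨ k ≡ i + t j + δ j [ZMOD m])))
include hmem

theorem celestialPointMod_mem_celestialLineMod (x y : Fin h × ZMod m) :
    celestialPointMod m v x ∈ celestialLineMod m s v y ↔
      (x.1 = y.1 ∧ (x.2 = y.2 ∨ x.2 = y.2 + s y.1)) ∨
      (x.1 = finRotate h y.1 ∧ (x.2 = y.2 + δ y.1 ∨ x.2 = y.2 + t y.1 + δ y.1)) := by
  simp only [celestialPointMod, celestialLineMod, hmem, ← ZMod.intCast_eq_intCast_iff,
    Int.cast_add, Int.cast_natCast, ZMod.intCast_zmod_cast]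

theorem celestialLineMod_injective (hh : 3 ≤ h) (hs : ∀ j, ¬ m ∣ 2 * s j) :
    Function.Injective (celestialLineMod m s v) := by
  have mem_iff := celestialPointMod_mem_celestialLineMod hmem
  rintro ⟨j, i⟩ ⟨j', i'⟩ hl
  have hne := finRotate_ne_self (by omega : 2 ≤ h) j'
  have first_mem := (mem_iff (j, i) (j, i)).2 (Or.inl ⟨rfl, Or.inl rfl⟩)
  have second_mem := (mem_iff (j, i + s j) (j, i)).2 (Or.inl ⟨rfl, Or.inr rfl⟩)
  have next_mem := (mem_iff (finRotate h j, i + δ j) (j, i)).2 (Or.inr ⟨rfl, Or.inl rfl⟩)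
  rw [hl, mem_iff] at first_mem second_mem next_mem
  obtain rfl : j = j' := by
    by_contra hj
    obtain rfl : j = finRotate h j' := (first_mem.resolve_left fun H ↦ hj H.1).1
    rcases next_mem with ⟨H, -⟩ | ⟨H, -⟩
    · exact finRotate_finRotate_ne_self hh j' H
    · exact hj ((finRotate h).injective H)
  have two_mul_ne_zero : (2 * s j : ZMod m) ≠ 0 := by
    exact_mod_cast (ZMod.natCast_eq_zero_iff (2 * s j) m).not.2 (hs j)
  grind

theorem encard_setOf_celestialPointMod_mem (hh : 2 ≤ h) (hs : ∀ j, ¬ m ∣ s j)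
    (ht : ∀ j, ¬ m ∣ t j) (y : Fin h × ZMod m) :
    {x | celestialPointMod m v x ∈ celestialLineMod m s v y}.encard = 4 := by
  obtain ⟨j, i⟩ := y
  have hs' := (ZMod.natCast_eq_zero_iff (s j) m).not.2 (hs j)
  have ht' := (ZMod.natCast_eq_zero_iff (t j) m).not.2 (ht j)
  have hne := (finRotate_ne_self hh j).symm
  rw [show (4 : ℕ∞) = ([(j, i), (j, i + s j), (finRotate h j, i + δ j),
    (finRotate h j, i + t j + δ j)] : List (Fin h × ZMod m)).length from rfl,
    ← encard_setOf_mem_list (by grind)]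
  congr 1
  ext x
  simp only [Set.mem_ofPred_eq, celestialPointMod_mem_celestialLineMod hmem, List.mem_cons,
    List.not_mem_nil, or_false, Prod.ext_iff]
  tauto

theorem encard_setOf_mem_celestialLineMod (hh : 2 ≤ h) (hs : ∀ j, ¬ m ∣ s j)
    (ht : ∀ j, ¬ m ∣ t j) (x : Fin h × ZMod m) :
    {y | celestialPointMod m v x ∈ celestialLineMod m s v y}.encard = 4 := by
  obtain ⟨a, k⟩ := x
  obtain ⟨j, rfl⟩ := (finRotate h).surjective a
  set a := finRotate h j with ha
  have hs' := (ZMod.natCast_eq_zero_iff (s a) m).not.2 (hs a)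
  have ht' := (ZMod.natCast_eq_zero_iff (t j) m).not.2 (ht j)
  have hne : a ≠ j := finRotate_ne_self hh j
  rw [show (4 : ℕ∞) = ([(a, k), (a, k - s a), (j, k - δ j), (j, k - t j - δ j)] :
      List (Fin h × ZMod m)).length from rfl,
    ← encard_setOf_mem_list (by grind)]
  congr 1
  ext ⟨b, i⟩
  simp only [Set.mem_ofPred_eq, celestialPointMod_mem_celestialLineMod hmem, List.mem_cons,
    List.not_mem_nil, or_false, Prod.ext_iff, ha, (finRotate h).injective.eq_iff]
  grind

theorem isConfiguration_celestial (hm : 0 < m) (hh : 3 ≤ h) (hs : ∀ j, ¬ m ∣ 2 * s j)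
    (ht : ∀ j, ¬ m ∣ t j)
    (heq : ∀ j j' i i', v j i = v j' i' ↔ j = j' ∧ i ≡ i' [ZMOD m]) :
    IsConfiguration extLines (m * h) 4 (celestialPoints v) (celestialLines s v) := by
  have : NeZero m := ⟨hm.ne'⟩
  have hs' (j) : ¬ m ∣ s j := fun H ↦ hs j (H.mul_left 2)
  have card : Nat.card (Fin h × ZMod m) = m * h := by
    rw [Nat.card_prod, Nat.card_fin, Nat.card_zmod, mul_comm]
  rw [← range_celestialPointMod heq, ← range_celestialLineMod heq]
  refine isConfiguration_range ?_ (celestialPointMod_injective heq)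
    (celestialLineMod_injective hmem hh hs) card card
    (encard_setOf_celestialPointMod_mem hmem (by omega) hs' ht)
    (encard_setOf_mem_celestialLineMod hmem (by omega) hs' ht)
  rintro ⟨j, i⟩
  refine ⟨_, _, toExt_injective.ne fun H ↦ hs' j ?_, rfl⟩
  have H' := ((heq _ _ _ _).1 H).2
  rw [Int.modEq_iff_dvd, add_sub_cancel_left] at H'
  exact_mod_cast H'

end Incidence

/-! ### Points and lines in polar coordinates -/

noncomputable section

/-- The point of the plane with polar coordinates `r` and `k π / m`. -/
def polar (m : ℕ) (r : ℝ) (k : ℤ) : Plane := !₂[r * cosMul m k, r * sinMul m k]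

/-- The line whose normal points in the direction `n π / m` and whose signed distance from the
origin is `d`. -/
def normalLine (m : ℕ) (d : ℝ) (n : ℤ) : Set ExtPlane :=
  lineOf ![cosMul m n, sinMul m n, -d]

end

section Polar

variable {m : ℕ}

theorem rotate_polar (e k : ℤ) (r : ℝ) :
    rotate (e * (Real.pi / m)) (polar m r k) = polar m r (k + e) := by
  have hcos : Real.cos (e * (Real.pi / m)) = cosMul m e := rfl
  have hsin : Real.sin (e * (Real.pi / m)) = sinMul m e := rfl
  simp only [rotate, polar, cosMul_add, sinMul_add, hcos, hsin]
  congr 2 <;> simp <;> ring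

theorem normalLine_mem_extLines (d : ℝ) (n : ℤ) : normalLine m d n ∈ extLines := by
  refine mem_extLines_iff.2 ⟨_, fun h ↦ ?_, rfl⟩
  have hcos : cosMul m n = 0 := congrFun h 0
  have hsin : sinMul m n = 0 := congrFun h 1
  simpa [hcos, hsin] using cosMul_sq_add_sinMul_sq (m := m) n

theorem toExt_polar_mem_normalLine (r d : ℝ) (k n : ℤ) :
    toExt (polar m r k) ∈ normalLine m d n ↔ r * cosMul m (k - n) = d := by
  rw [normalLine, toExt_mem_lineOf, cosMul_sub, ← sub_eq_zero (b := d)]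
  refine Eq.congr_left ?_
  simp [polar]
  ring

theorem polar_eq_iff (hm : 0 < m) {r r' : ℝ} (hr : 0 < r) (hr' : 0 < r') (k k' : ℤ) :
    polar m r k = polar m r' k' ↔ r = r' ∧ k ≡ k' [ZMOD 2 * m] := by
  rw [← cosMul_sinMul_eq_iff hm]
  constructor
  · intro h
    have hx : r * cosMul m k = r' * cosMul m k' := congrArg (fun x : Plane ↦ x 0) h
    have hy : r * sinMul m k = r' * sinMul m k' := congrArg (fun x : Plane ↦ x 1) h
    have norm_sq (r : ℝ) (k : ℤ) : (r * cosMul m k) ^ 2 + (r * sinMul m k) ^ 2 = r ^ 2 := by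
      rw [mul_pow, mul_pow, ← mul_add, cosMul_sq_add_sinMul_sq, mul_one]
    obtain rfl : r = r' := by
      rw [← pow_left_inj₀ hr.le hr'.le two_ne_zero, ← norm_sq r k, ← norm_sq r' k', hx, hy]
    exact ⟨rfl, mul_left_cancel₀ hr.ne' hx, mul_left_cancel₀ hr.ne' hy⟩
  · rintro ⟨rfl, hcos, hsin⟩
    rw [polar, polar, hcos, hsin]

theorem cosMul_two_mul_sub_eq_iff (hm : 0 < m) (x q : ℤ) :
    cosMul m (2 * x - q) = cosMul m q ↔ x ≡ 0 [ZMOD m] ∨ x ≡ q [ZMOD m] := by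
  rw [cosMul_eq_iff hm, or_comm]
  simp only [Int.modEq_iff_dvd]
  rw [show -q - (2 * x - q) = 2 * (0 - x) by ring, show q - (2 * x - q) = 2 * (q - x) by ring,
    mul_dvd_mul_iff_left two_ne_zero, mul_dvd_mul_iff_left two_ne_zero]

end Polar

/-! ### The standard construction of celestial configurations -/

section Symbol

variable {h : ℕ} {m : ℕ} {s t : Fin h → ℕ}

noncomputable section

/-- The radius `r_j` of the circle that carries the points `(v_j)_i`. -/
def classRadius (m : ℕ) (s t : Fin h → ℕ) (j : Fin h) : ℝ :=
  ∏ a ∈ Finset.Iio j, cosMul m (s a) / cosMul m (t a)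

/-- The angle of the point `(v_j)_0`, in units of `π / m`. -/
def classOffset (s t : Fin h → ℕ) (j : Fin h) : ℤ := ∑ a ∈ Finset.Iio j, ((s a : ℤ) - t a)

/-- The distance of the lines `(L_j)_i` from the origin. -/
def apothem (m : ℕ) (s t : Fin h → ℕ) (j : Fin h) : ℝ :=
  classRadius m s t j * cosMul m (s j)

/-- The index shift with which the line class `L_j` meets the point class `v_{j+1}`. -/
def closingShift (s t : Fin h → ℕ) (j : Fin h) : ℤ :=
  if (j : ℕ) + 1 = h then twist s t else 0

/-- The conditions on a symbol under which the standard construction closes up and gives a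
celestial configuration without accidental coincidences and incidences. Angles are in units of
`π / m`; as the points of the class `v_a` lie in the directions `classOffset s t a + 2 i`, only
the parities of the angles between different classes matter. -/
structure IsValidSymbol (m : ℕ) (s t : Fin h → ℕ) : Prop where
  cosMul_s_pos : ∀ j, 0 < cosMul m (s j)
  cosMul_t_pos : ∀ j, 0 < cosMul m (t j)
  not_dvd_two_mul_s : ∀ j, ¬ m ∣ 2 * s j
  not_dvd_t : ∀ j, ¬ m ∣ t j
  even_sum : Even (∑ j, ((s j : ℤ) - t j))
  prod_eq : ∏ j, cosMul m (s j) = ∏ j, cosMul m (t j)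
  eq_of_classRadius_eq : ∀ a b, classRadius m s t a = classRadius m s t b →
    classOffset s t a ≡ classOffset s t b [ZMOD 2] → a = b
  not_incident : ∀ a j, a ≠ j → a ≠ finRotate h j → ∀ e : ℤ,
    e ≡ classOffset s t a - (classOffset s t j + s j) [ZMOD 2] →
    classRadius m s t a * cosMul m e ≠ apothem m s t j

end

theorem celestialPoint_eq_polar (j : Fin h) (i : ℤ) :
    celestialPoint m s t j i = polar m (classRadius m s t j) (classOffset s t j + 2 * i) := by
  have hangle (a : ℕ) : (a : ℝ) * Real.pi / m = ((a : ℤ) : ℝ) * (Real.pi / m) := by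
    rw [Int.cast_natCast, mul_div_assoc]
  have hoffset : (∑ a ∈ Finset.Iio j, ((s a : ℝ) - t a)) * Real.pi / m + 2 * Real.pi * i / m =
      (classOffset s t j + 2 * i : ℤ) * (Real.pi / m) := by
    simp only [classOffset]
    push_cast
    ring
  simp only [celestialPoint, polar, classRadius, cosMul, sinMul, hangle, hoffset]

@[to_additive]
theorem prod_Iio_finRotate {M : Type*} [CommMonoid M] (f : Fin h → M) (j : Fin h) :
    (∏ a ∈ Finset.Iio (finRotate h j), f a) * (if (j : ℕ) + 1 = h then ∏ a, f a else 1) =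
      (∏ a ∈ Finset.Iio j, f a) * f j := by
  have insert_Iio : (∏ a ∈ Finset.Iio j, f a) * f j = ∏ a ∈ Finset.Iic j, f a := by
    rw [← Finset.Iio_insert, Finset.prod_insert Finset.notMem_Iio_self, mul_comm]
  rw [insert_Iio]
  obtain ⟨n, rfl⟩ : ∃ n, h = n + 1 := ⟨h - 1, by have := j.pos; omega⟩
  split_ifs with hj
  · obtain rfl : j = Fin.last n := Fin.ext (by simpa using hj)
    have Iio_zero : Finset.Iio (0 : Fin (n + 1)) = ∅ := by ext a; simp
    have Iic_last : Finset.Iic (Fin.last n) = Finset.univ := by ext a; simp [Fin.le_last]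
    rw [finRotate_last, Iio_zero, Iic_last, Finset.prod_empty, one_mul]
  · rw [mul_one]
    congr 1
    ext a
    have hval : (finRotate (n + 1) j : ℕ) = j + 1 :=
      coe_finRotate_of_ne_last fun H ↦ hj (by rw [H, Fin.val_last])
    rw [Finset.mem_Iio, Finset.mem_Iic, Fin.lt_def, hval, Nat.lt_succ_iff, Fin.le_def]

namespace IsValidSymbol

variable (hst : IsValidSymbol m s t)
include hst

theorem classRadius_pos (j : Fin h) : 0 < classRadius m s t j :=
  Finset.prod_pos fun a _ ↦ div_pos (hst.cosMul_s_pos a) (hst.cosMul_t_pos a)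

theorem classRadius_finRotate_mul (j : Fin h) :
    classRadius m s t (finRotate h j) * cosMul m (t j) = apothem m s t j := by
  have total : ∏ a, cosMul m (s a) / cosMul m (t a) = 1 := by
    rw [Finset.prod_div_distrib, hst.prod_eq]
    exact div_self (Finset.prod_ne_zero_iff.2 fun a _ ↦ (hst.cosMul_t_pos a).ne')
  have next := prod_Iio_finRotate (fun a ↦ cosMul m (s a) / cosMul m (t a)) j
  rw [total, ite_self, mul_one] at next
  rw [classRadius, next, mul_assoc, div_mul_cancel₀ _ (hst.cosMul_t_pos j).ne', apothem,
    classRadius]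

theorem classOffset_finRotate (j : Fin h) :
    classOffset s t (finRotate h j) + 2 * closingShift s t j + t j = classOffset s t j + s j := by
  have next := sum_Iio_finRotate (fun a ↦ (s a : ℤ) - t a) j
  have total : 2 * twist s t = ∑ a, ((s a : ℤ) - t a) :=
    Int.mul_ediv_cancel' hst.even_sum.two_dvd
  rw [← total] at next
  rw [closingShift, classOffset, classOffset]
  split_ifs at next ⊢ <;> linarith

theorem celestialPoint_eq_iff (hm : 0 < m) (j j' : Fin h) (i i' : ℤ) :
    celestialPoint m s t j i = celestialPoint m s t j' i' ↔ j = j' ∧ i ≡ i' [ZMOD m] := by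
  rw [celestialPoint_eq_polar, celestialPoint_eq_polar,
    polar_eq_iff hm (hst.classRadius_pos j) (hst.classRadius_pos j')]
  have same_class : classOffset s t j + 2 * i ≡ classOffset s t j + 2 * i' [ZMOD 2 * m] ↔
      i ≡ i' [ZMOD m] := by
    rw [Int.modEq_iff_dvd, Int.modEq_iff_dvd, add_sub_add_left_eq_sub, ← mul_sub,
      mul_dvd_mul_iff_left two_ne_zero]
  constructor
  · rintro ⟨hr, hi⟩
    obtain rfl := hst.eq_of_classRadius_eq j j' hr <| by
      have parity := hi.of_mul_right m
      rw [Int.modEq_iff_dvd] at parity ⊢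
      omega
    exact ⟨rfl, same_class.1 hi⟩
  · rintro ⟨rfl, hi⟩
    exact ⟨rfl, same_class.2 hi⟩

theorem celestialPoint_mem_normalLine_iff (hm : 0 < m) (hh : 2 ≤ h) (a j : Fin h) (k i : ℤ) :
    toExt (celestialPoint m s t a k) ∈
        normalLine m (apothem m s t j) (classOffset s t j + s j + 2 * i) ↔
      (a = j ∧ (k ≡ i [ZMOD m] ∨ k ≡ i + s j [ZMOD m])) ∨
      (a = finRotate h j ∧
        (k ≡ i + closingShift s t j [ZMOD m] ∨ k ≡ i + t j + closingShift s t j [ZMOD m])) := by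
  have modEq_sub (x y : ℤ) : k - y ≡ x [ZMOD m] ↔ k ≡ x + y [ZMOD m] := by
    rw [Int.modEq_iff_dvd, Int.modEq_iff_dvd]
    ring_nf
  rw [celestialPoint_eq_polar, toExt_polar_mem_normalLine]
  by_cases own : a = j
  · subst own
    have angle : classOffset s t a + 2 * k - (classOffset s t a + s a + 2 * i) =
        2 * (k - i) - s a := by ring
    rw [angle, apothem, mul_right_inj' (hst.classRadius_pos a).ne', cosMul_two_mul_sub_eq_iff hm,
      modEq_sub, modEq_sub, zero_add, add_comm (s a : ℤ)]
    simp only [true_and, (finRotate_ne_self hh a).symm, false_and, or_false]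
  by_cases next : a = finRotate h j
  · subst next
    have angle : classOffset s t (finRotate h j) + 2 * k - (classOffset s t j + s j + 2 * i) =
        2 * (k - (i + closingShift s t j)) - t j := by
      rw [← hst.classOffset_finRotate j]
      ring
    rw [angle, ← hst.classRadius_finRotate_mul, mul_right_inj' (hst.classRadius_pos _).ne',
      cosMul_two_mul_sub_eq_iff hm, modEq_sub, modEq_sub, zero_add, ← add_assoc,
      add_comm (t j : ℤ), add_right_comm]
    simp only [true_and, finRotate_ne_self hh j, false_and, false_or]
  · simp only [own, next, false_and, or_self, iff_false]
    refine hst.not_incident a j own next _ ?_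
    rw [Int.modEq_iff_dvd]
    omega

theorem celestialLine_eq_normalLine (hm : 0 < m) (hh : 2 ≤ h) (j : Fin h) (i : ℤ) :
    celestialLine s (celestialPoint m s t) j i =
      normalLine m (apothem m s t j) (classOffset s t j + s j + 2 * i) := by
  have mem_iff (k : ℤ) := hst.celestialPoint_mem_normalLine_iff hm hh j j k i
  refine (eq_join_of_mem (normalLine_mem_extLines _ _) (toExt_injective.ne fun H ↦ ?_)
    ((mem_iff _).2 (Or.inl ⟨rfl, Or.inl rfl⟩)) ((mem_iff _).2 (Or.inl ⟨rfl, Or.inr rfl⟩))).symm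
  have hs := ((hst.celestialPoint_eq_iff hm _ _ _ _).1 H).2
  rw [Int.modEq_iff_dvd, add_sub_cancel_left] at hs
  exact hst.not_dvd_two_mul_s j (dvd_mul_of_dvd_right (by exact_mod_cast hs) 2)

theorem isCelestial (hm : 0 < m) (hh : 3 ≤ h) : IsCelestial m s t (celestialPoint m s t) := by
  have mem_iff (a : Fin h) (k : ℤ) (j : Fin h) (i : ℤ) :=
    hst.celestialLine_eq_normalLine hm (by omega) j i ▸
      hst.celestialPoint_mem_normalLine_iff hm (by omega) a j k i
  have eq_iff := hst.celestialPoint_eq_iff hm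
  refine ⟨hst.even_sum, fun j i ↦ ?_, eq_iff, isConfiguration_celestial mem_iff hm hh
    hst.not_dvd_two_mul_s hst.not_dvd_t eq_iff, mem_iff⟩
  have step : 2 * Real.pi / m = (2 : ℤ) * (Real.pi / m) := by
    push_cast
    ring
  rw [celestialPoint_eq_polar, celestialPoint_eq_polar, step, rotate_polar]
  ring_nf

end IsValidSymbol

end Symbol

/-! ### The symbol `2ℓ#(2,1;4,3;1,2;3,4)` -/

section Trivial

variable {m : ℕ}

theorem Iio_fin_four : Finset.Iio (0 : Fin 4) = ∅ ∧ Finset.Iio (1 : Fin 4) = {0} ∧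
    Finset.Iio (2 : Fin 4) = {0, 1} ∧ Finset.Iio (3 : Fin 4) = {0, 1, 2} := by decide

theorem classOffset_spanS_spanT (j : Fin 4) :
    classOffset spanS spanT j = (![0, 1, 2, 1] : Fin 4 → ℤ) j := by
  fin_cases j <;> decide

theorem classRadius_spanS_spanT (h1 : cosMul m 1 ≠ 0) (h2 : cosMul m 2 ≠ 0) (j : Fin 4) :
    classRadius m spanS spanT j =
      (![1, cosMul m 2 / cosMul m 1, cosMul m 2 * cosMul m 4 / (cosMul m 1 * cosMul m 3),
        cosMul m 4 / cosMul m 3] : Fin 4 → ℝ) j := by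
  obtain ⟨I0, I1, I2, I3⟩ := Iio_fin_four
  fin_cases j
  · simp [classRadius, I0]
  · simp [classRadius, I1, spanS, spanT]
  · simp [classRadius, I2, spanS, spanT, mul_div_mul_comm]
  · simp [classRadius, I3, spanS, spanT]
    field_simp

theorem apothem_spanS_spanT (h1 : cosMul m 1 ≠ 0) (h2 : cosMul m 2 ≠ 0) (h3 : cosMul m 3 ≠ 0)
    (j : Fin 4) :
    apothem m spanS spanT j =
      (![cosMul m 2, cosMul m 2 * cosMul m 4 / cosMul m 1, cosMul m 2 * cosMul m 4 / cosMul m 3,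
        cosMul m 4] : Fin 4 → ℝ) j := by
  rw [apothem, classRadius_spanS_spanT h1 h2]
  fin_cases j <;> simp [spanS] <;> field_simp

theorem eq_of_classRadius_spanS_spanT_eq (hm : 9 ≤ m) {a b : Fin 4}
    (h : classRadius m spanS spanT a = classRadius m spanS spanT b)
    (hab : classOffset spanS spanT a ≡ classOffset spanS spanT b [ZMOD 2]) : a = b := by
  have h1 : 0 < cosMul m 1 := cosMul_pos (by omega) (by omega) (by omega)
  have h2 : 0 < cosMul m 2 := cosMul_pos (by omega) (by omega) (by omega)
  have h3 : 0 < cosMul m 3 := cosMul_pos (by omega) (by omega) (by omega)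
  have radius_two_lt : cosMul m 4 * cosMul m 2 < cosMul m 3 * cosMul m 1 := by
    apply cosMul_mul_cosMul_lt <;> omega
  have radius_three_lt : cosMul m 4 * cosMul m 1 < cosMul m 3 * cosMul m 2 := by
    apply cosMul_mul_cosMul_lt <;> omega
  simp only [classRadius_spanS_spanT h1.ne' h2.ne', classOffset_spanS_spanT] at h hab
  fin_cases a <;> fin_cases b <;> simp at h hab ⊢
  all_goals field_simp at h
  all_goals first | exact absurd hab (by decide) | linarith

theorem classRadius_mul_cosMul_ne_apothem (hm : 9 ≤ m) (a j : Fin 4) (haj : a ≠ j)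
    (haj' : a ≠ finRotate 4 j) (e : ℤ)
    (he : e ≡ classOffset spanS spanT a - (classOffset spanS spanT j + spanS j) [ZMOD 2]) :
    classRadius m spanS spanT a * cosMul m e ≠ apothem m spanS spanT j := by
  have hm' : 0 < m := by omega
  have h1 : 0 < cosMul m 1 := cosMul_pos (by omega) (by omega) (by omega)
  have h2 : 0 < cosMul m 2 := cosMul_pos (by omega) (by omega) (by omega)
  have h3 : 0 < cosMul m 3 := cosMul_pos (by omega) (by omega) (by omega)
  have h4 : 0 < cosMul m 4 := cosMul_pos (by omega) (by omega) (by omega)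
  rw [classRadius_spanS_spanT h1.ne' h2.ne', apothem_spanS_spanT h1.ne' h2.ne' h3.ne']
  rw [classOffset_spanS_spanT, classOffset_spanS_spanT] at he
  fin_cases j <;> fin_cases a <;>
    first
    | exact absurd rfl haj
    | exact absurd (by decide) haj'
    | (intro h
       clear haj haj'
       simp only [Fin.reduceFinMk, Fin.zero_eta, Fin.mk_one, Fin.isValue, Matrix.cons_val,
         Matrix.cons_val_zero, Matrix.cons_val_one, spanS, Nat.cast_ofNat, one_mul] at h he
       field_simp at h)
  · have le := mul_le_mul_of_nonneg_left (cosMul_le_of_modEq hm' le_rfl zero_le_one he) h4.le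
    have lt : cosMul m 4 * cosMul m 0 < cosMul m 3 * cosMul m 1 := by
      apply cosMul_mul_cosMul_lt <;> omega
    linarith
  · have le := mul_le_mul_of_nonneg_left
      (cosMul_le_of_modEq hm' zero_le_one le_rfl (he.trans (by decide))) h4.le
    have lt : cosMul m 4 * cosMul m 1 < cosMul m 3 * cosMul m 2 := by
      apply cosMul_mul_cosMul_lt <;> omega
    linarith
  · refine (?_ : cosMul m e * cosMul m 1 ≠ cosMul m 4 * cosMul m 2) (by linarith)
    apply cosMul_mul_cosMul_ne hm' h1 (k := 3) (hek := he.trans (by decide)) <;> omega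
  · refine (?_ : cosMul m e * cosMul m 1 ≠ cosMul m 3 * cosMul m 2) (by linarith)
    apply cosMul_mul_cosMul_ne hm' h1 (k := 2) (hek := he.trans (by decide)) <;> omega
  · refine (?_ : cosMul m e * cosMul m 3 ≠ cosMul m 4 * cosMul m 2) (by linarith)
    apply cosMul_mul_cosMul_ne hm' h3 (k := 3) (hek := he.trans (by decide)) <;> omega
  · have low : cosMul m 4 * cosMul m 3 < cosMul m 4 * cosMul m 1 :=
      mul_lt_mul_of_pos_left (cosMul_lt hm' (by omega) (by omega) (by omega)) h4
    have high : cosMul m 4 * cosMul m 1 < cosMul m 3 * cosMul m 2 := by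
      apply cosMul_mul_cosMul_lt <;> omega
    exact cosMul_mul_ne hm' h3 (k := 2) (by norm_num) (by omega) (he.trans (by decide))
      low (by linarith) (by linarith)
  · refine (?_ : cosMul m e * cosMul m 2 ≠ cosMul m 4 * cosMul m 1) (by linarith)
    apply cosMul_mul_cosMul_ne hm' h2 (k := 3) (hek := he.trans (by decide)) <;> omega
  · refine (?_ : cosMul m e * cosMul m 2 ≠ cosMul m 3 * cosMul m 1) (by linarith)
    apply cosMul_mul_cosMul_ne hm' h2 (k := 2) (hek := he.trans (by decide)) <;> omega

theorem spanS_mem_Icc (j : Fin 4) : spanS j ∈ Finset.Icc 1 4 := by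
  revert j
  decide

theorem spanT_mem_Icc (j : Fin 4) : spanT j ∈ Finset.Icc 1 4 := by
  revert j
  decide

theorem isValidSymbol_spanS_spanT (hm : 9 ≤ m) : IsValidSymbol m spanS spanT := by
  have hs (j) := Finset.mem_Icc.1 (spanS_mem_Icc j)
  have ht (j) := Finset.mem_Icc.1 (spanT_mem_Icc j)
  exact {
    cosMul_s_pos := fun j ↦ cosMul_pos (by omega) (by omega) (by specialize hs j; omega)
    cosMul_t_pos := fun j ↦ cosMul_pos (by omega) (by omega) (by specialize ht j; omega)
    not_dvd_two_mul_s := fun j ↦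
      Nat.not_dvd_of_pos_of_lt (by specialize hs j; omega) (by specialize hs j; omega)
    not_dvd_t := fun j ↦
      Nat.not_dvd_of_pos_of_lt (by specialize ht j; omega) (by specialize ht j; omega)
    even_sum := by decide
    prod_eq := by
      simp [Fin.prod_univ_four, spanS, spanT]
      ring
    eq_of_classRadius_eq := fun _ _ ↦ eq_of_classRadius_spanS_spanT_eq hm
    not_incident := classRadius_mul_cosMul_ne_apothem hm }

end Trivial

/-! ### Lines through the centre and points at infinity -/

noncomputable section

/-- The line through the origin in the direction `k π / m`. -/
def centralLine (m : ℕ) (k : ℤ) : Set ExtPlane := lineOf ![-sinMul m k, cosMul m k, 0]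

/-- The point at infinity in the direction `k π / m`. -/
def infinitePoint (m : ℕ) (k : ℤ) : ExtPlane :=
  Projectivization.mk ℝ ![cosMul m k, sinMul m k, 0] fun h ↦ by
    have hcos : cosMul m k = 0 := congrFun h 0
    have hsin : sinMul m k = 0 := congrFun h 1
    simpa [hcos, hsin] using cosMul_sq_add_sinMul_sq (m := m) k

end

section Central

variable {m : ℕ}

theorem centralLine_mem_extLines (k : ℤ) : centralLine m k ∈ extLines := by
  refine mem_extLines_iff.2 ⟨_, fun h ↦ ?_, rfl⟩
  have hsin : -sinMul m k = 0 := congrFun h 0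
  have hcos : cosMul m k = 0 := congrFun h 1
  simpa [hcos, neg_eq_zero.1 hsin] using cosMul_sq_add_sinMul_sq (m := m) k

theorem toExt_zero_mem_centralLine (k : ℤ) : toExt 0 ∈ centralLine m k := by
  rw [centralLine, toExt_mem_lineOf]
  simp

theorem toExt_zero_mem_normalLine_iff (d : ℝ) (n : ℤ) : toExt 0 ∈ normalLine m d n ↔ d = 0 := by
  rw [normalLine, toExt_mem_lineOf]
  simp

theorem infinitePoint_mem_lineAtInfinity (k : ℤ) : infinitePoint m k ∈ lineAtInfinity := by
  rw [lineAtInfinity_eq_lineOf, infinitePoint, mk_mem_lineOf]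
  simp [dotProduct, Fin.sum_univ_three]

theorem infinitePoint_mem_normalLine_iff (d : ℝ) (k n : ℤ) :
    infinitePoint m k ∈ normalLine m d n ↔ cosMul m (k - n) = 0 := by
  rw [infinitePoint, normalLine, mk_mem_lineOf, cosMul_sub]
  simp [dotProduct, Fin.sum_univ_three]

variable (hm : 0 < m)
include hm

theorem infinitePoint_mem_centralLine_iff (k n : ℤ) :
    infinitePoint m k ∈ centralLine m n ↔ k ≡ n [ZMOD m] := by
  rw [← sinMul_sub_eq_zero_iff hm, sinMul_sub, infinitePoint,
    centralLine, mk_mem_lineOf]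
  refine Eq.congr_left ?_
  simp [dotProduct, Fin.sum_univ_three]
  ring

theorem toExt_polar_mem_centralLine_iff {r : ℝ} (hr : r ≠ 0) (k n : ℤ) :
    toExt (polar m r k) ∈ centralLine m n ↔ k ≡ n [ZMOD m] := by
  rw [← sinMul_sub_eq_zero_iff hm, sinMul_sub,
    ← mul_eq_zero_iff_left hr, centralLine, toExt_mem_lineOf]
  refine Eq.congr_left ?_
  simp [polar]
  ring

theorem join_toExt_zero_toExt_polar {r : ℝ} (hr : r ≠ 0) (k : ℤ) :
    join (toExt 0) (toExt (polar m r k)) = centralLine m k := by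
  refine (eq_join_of_mem (centralLine_mem_extLines k) (toExt_injective.ne fun h ↦ ?_)
    (toExt_zero_mem_centralLine k) ((toExt_polar_mem_centralLine_iff hm hr k k).2 rfl)).symm
  refine hr ((toExt_zero_mem_normalLine_iff (m := m) r k).1 ?_)
  rw [h, toExt_polar_mem_normalLine, sub_self, cosMul_zero, mul_one]

theorem eq_infinitePoint_iff {x : ExtPlane} (k : ℤ) :
    x = infinitePoint m k ↔ x ∈ lineAtInfinity ∧ x ∈ centralLine m k := by
  have mem_centralLine := (infinitePoint_mem_centralLine_iff hm k k).2 rfl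
  constructor
  · rintro rfl
    exact ⟨infinitePoint_mem_lineAtInfinity k, mem_centralLine⟩
  · refine fun hx ↦ eq_of_mem_inter lineAtInfinity_mem_extLines (centralLine_mem_extLines k)
      (fun h ↦ ?_) hx ⟨infinitePoint_mem_lineAtInfinity k, mem_centralLine⟩
    exact toExt_notMem_lineAtInfinity 0 (h ▸ toExt_zero_mem_centralLine k)

theorem infinitePoint_eq_iff (k n : ℤ) :
    infinitePoint m k = infinitePoint m n ↔ k ≡ n [ZMOD m] := by
  rw [eq_infinitePoint_iff hm, infinitePoint_mem_centralLine_iff hm]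
  exact and_iff_right (infinitePoint_mem_lineAtInfinity k)

theorem centralLine_eq_iff (k n : ℤ) : centralLine m k = centralLine m n ↔ k ≡ n [ZMOD m] := by
  rw [← infinitePoint_mem_centralLine_iff hm]
  constructor
  · intro h
    rw [← h, infinitePoint_mem_centralLine_iff hm]
  · intro h
    refine eq_of_mem_of_mem (centralLine_mem_extLines k) (centralLine_mem_extLines n)
      (fun heq ↦ ?_) (toExt_zero_mem_centralLine k)
      ((infinitePoint_mem_centralLine_iff hm k k).2 rfl) (toExt_zero_mem_centralLine n) h
    exact toExt_notMem_lineAtInfinity 0 (heq ▸ infinitePoint_mem_lineAtInfinity k)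

theorem encard_range_of_eq_iff_modEq {X : Type*} {f : ℤ → X}
    (hf : ∀ k n, f k = f n ↔ k ≡ n [ZMOD m]) : (Set.range f).encard = m := by
  have : NeZero m := ⟨hm.ne'⟩
  have hinj : Function.Injective fun x : ZMod m ↦ f x.cast := fun x y hxy ↦ by
    simpa [← ZMod.intCast_eq_intCast_iff] using (hf _ _).1 hxy
  have hrange : Set.range f = Set.range fun x : ZMod m ↦ f x.cast := by
    refine (Set.range_subset_iff.2 fun k ↦ ?_).antisymm (Set.range_comp_subset_range _ f)
    exact ⟨k, (hf _ _).2 (zmod_cast_modEq k)⟩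
  rw [hrange, encard_range hinj, Nat.card_zmod]

theorem encard_sep_infinitePoint_mem_centralLine (n : ℤ) :
    {x ∈ Set.range (infinitePoint m) | x ∈ centralLine m n}.encard = 1 := by
  refine Set.encard_eq_one.2 ⟨infinitePoint m n, Set.eq_singleton_iff_unique_mem.2
    ⟨⟨⟨n, rfl⟩, (infinitePoint_mem_centralLine_iff hm n n).2 rfl⟩, ?_⟩⟩
  rintro _ ⟨⟨k, rfl⟩, hk⟩
  rwa [infinitePoint_eq_iff hm, ← infinitePoint_mem_centralLine_iff hm]

theorem encard_sep_centralLine {p : ExtPlane} {θ : ℤ}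
    (hp : ∀ n, p ∈ centralLine m n ↔ θ ≡ n [ZMOD m]) :
    {l ∈ Set.range (centralLine m) | p ∈ l}.encard = 1 := by
  refine Set.encard_eq_one.2 ⟨centralLine m θ, Set.eq_singleton_iff_unique_mem.2
    ⟨⟨⟨θ, rfl⟩, (hp θ).2 rfl⟩, ?_⟩⟩
  rintro _ ⟨⟨n, rfl⟩, hn⟩
  exact (centralLine_eq_iff hm _ _).2 ((hp n).1 hn).symm

theorem isConfiguration_infinitePoint_centralLine :
    IsConfiguration extLines m 1 (Set.range (infinitePoint m)) (Set.range (centralLine m)) where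
  isLine := Set.range_subset_iff.2 centralLine_mem_extLines
  card_points := encard_range_of_eq_iff_modEq hm (infinitePoint_eq_iff hm)
  card_lines := encard_range_of_eq_iff_modEq hm (centralLine_eq_iff hm)
  points_on_line := by
    rintro _ ⟨n, rfl⟩
    exact encard_sep_infinitePoint_mem_centralLine hm n
  lines_through_point := by
    rintro _ ⟨k, rfl⟩
    exact encard_sep_centralLine hm (infinitePoint_mem_centralLine_iff hm k)

end Central

/-! ### Adding the central lines to a celestial configuration -/

theorem encard_sep_infinitePoint_mem_normalLine {ℓ : ℕ} (hℓ : 0 < ℓ) (d : ℝ) (n : ℤ) :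
    {x ∈ Set.range (infinitePoint (2 * ℓ)) | x ∈ normalLine (2 * ℓ) d n}.encard = 1 := by
  have mem_iff (k : ℤ) : infinitePoint (2 * ℓ) k ∈ normalLine (2 * ℓ) d n ↔
      k ≡ n + ℓ [ZMOD (2 * ℓ : ℕ)] := by
    rw [infinitePoint_mem_normalLine_iff, cosMul_two_mul_eq_zero_iff hℓ, Int.modEq_iff_dvd,
      Int.modEq_iff_dvd, sub_sub_eq_add_sub, add_comm]
  refine Set.encard_eq_one.2 ⟨infinitePoint (2 * ℓ) (n + ℓ), Set.eq_singleton_iff_unique_mem.2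
    ⟨⟨⟨n + ℓ, rfl⟩, (mem_iff _).2 rfl⟩, ?_⟩⟩
  rintro _ ⟨⟨k, rfl⟩, hk⟩
  exact (infinitePoint_eq_iff (by positivity) _ _).2 ((mem_iff k).1 hk)

theorem two_mul_modEq_two_mul_iff (ℓ i c : ℤ) :
    2 * i ≡ 2 * c [ZMOD 2 * ℓ] ↔ ∃ e : Fin 2, i ≡ c + e * ℓ [ZMOD 2 * ℓ] := by
  simp only [Int.modEq_iff_dvd, ← mul_sub, mul_dvd_mul_iff_left (two_ne_zero (α := ℤ))]
  constructor
  · rintro ⟨q, hq⟩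
    obtain ⟨r, rfl | rfl⟩ := Int.even_or_odd' q
    · exact ⟨0, r, by simp; linear_combination hq⟩
    · exact ⟨1, r + 1, by simp; linear_combination hq⟩
  · rintro ⟨e, r, hr⟩
    exact ⟨2 * r - e, by linear_combination hr⟩

theorem encard_setOf_add_two_mul_modEq {ι : Type*} {ℓ : ℕ} (hℓ : 0 < ℓ) (f : ι → ℤ) (N : ℤ) :
    {x : ι × ZMod (2 * ℓ) | f x.1 + 2 * x.2.cast ≡ N [ZMOD 2 * ℓ]}.encard =
      {j | f j ≡ N [ZMOD 2]}.encard * 2 := by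
  set solution : ι × Fin 2 → ι × ZMod (2 * ℓ) :=
    fun y ↦ (y.1, (((N - f y.1) / 2 + y.2 * ℓ : ℤ) : ZMod (2 * ℓ)))
  have solution_injective : Function.Injective solution := by
    rintro ⟨j, e⟩ ⟨j', e'⟩ h
    obtain ⟨rfl, he⟩ := Prod.ext_iff.1 h
    have he' := (ZMod.intCast_eq_intCast_iff _ _ _).1 he
    rw [Int.modEq_iff_dvd, add_sub_add_left_eq_sub, ← sub_mul, Nat.cast_mul,
      mul_dvd_mul_iff_right (by exact_mod_cast hℓ.ne')] at he'
    grind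
  have solutions : {x : ι × ZMod (2 * ℓ) | f x.1 + 2 * x.2.cast ≡ N [ZMOD 2 * ℓ]} =
      solution '' ({j | f j ≡ N [ZMOD 2]} ×ˢ Set.univ) := by
    ext ⟨j, i⟩
    have solution_eq (e : Fin 2) : solution (j, e) = (j, i) ↔
        i.cast ≡ (N - f j) / 2 + e * ℓ [ZMOD 2 * ℓ] := by
      rw [Prod.ext_iff, and_iff_right rfl, ← ZMod.intCast_zmod_cast i,
        ZMod.intCast_eq_intCast_iff, ZMod.intCast_zmod_cast, Int.modEq_comm, Nat.cast_mul,
        Nat.cast_two]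
    have parity (hj : f j ≡ N [ZMOD 2]) : f j + 2 * i.cast ≡ N [ZMOD 2 * ℓ] ↔
        2 * i.cast ≡ 2 * ((N - f j) / 2) [ZMOD 2 * ℓ] := by
      rw [Int.mul_ediv_cancel' hj.dvd, Int.modEq_iff_dvd, Int.modEq_iff_dvd, sub_sub]
    constructor
    · intro hi
      have hj : f j ≡ N [ZMOD 2] := by
        have hi' := Int.ModEq.of_mul_right (ℓ : ℤ) hi
        rw [Int.modEq_iff_dvd, ← sub_sub, dvd_sub_left (dvd_mul_right 2 _)] at hi'
        exact Int.modEq_iff_dvd.2 hi'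
      obtain ⟨e, he⟩ := (two_mul_modEq_two_mul_iff _ _ _).1 ((parity hj).1 hi)
      exact ⟨(j, e), ⟨hj, trivial⟩, (solution_eq e).2 he⟩
    · rintro ⟨⟨j', e⟩, ⟨hj, -⟩, h⟩
      obtain rfl : j' = j := congrArg Prod.fst h
      exact (parity hj).2 ((two_mul_modEq_two_mul_iff _ _ _).2 ⟨e, (solution_eq e).1 h⟩)
  rw [solutions, solution_injective.encard_image, Set.encard_prod, Set.encard_univ,
    ENat.card_eq_coe_fintype_card]
  rfl

namespace IsValidSymbol

section

variable {h m : ℕ} {s t : Fin h → ℕ} (hst : IsValidSymbol m s t)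
include hst

theorem apothem_pos (j : Fin h) : 0 < apothem m s t j :=
  mul_pos (hst.classRadius_pos j) (hst.cosMul_s_pos j)

theorem celestialPoint_mem_centralLine_iff (hm : 0 < m) (j : Fin h) (i n : ℤ) :
    toExt (celestialPoint m s t j i) ∈ centralLine m n ↔
      classOffset s t j + 2 * i ≡ n [ZMOD m] := by
  rw [celestialPoint_eq_polar, toExt_polar_mem_centralLine_iff hm (hst.classRadius_pos j).ne']

theorem exists_mem_centralLine_iff (hm : 0 < m) {p : ExtPlane}
    (hp : p ∈ celestialPoints (celestialPoint m s t) ∪ Set.range (infinitePoint m)) :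
    ∃ θ, ∀ n, p ∈ centralLine m n ↔ θ ≡ n [ZMOD m] := by
  rcases hp with ⟨j, i, rfl⟩ | ⟨k, rfl⟩
  · exact ⟨_, hst.celestialPoint_mem_centralLine_iff hm j i⟩
  · exact ⟨k, infinitePoint_mem_centralLine_iff hm k⟩

theorem disjoint_centralLine_inter_centralLine (hm : 0 < m) {n n' : ℤ} (hn : ¬ n ≡ n' [ZMOD m]) :
    Disjoint (celestialPoints (celestialPoint m s t) ∪ Set.range (infinitePoint m))
      (centralLine m n ∩ centralLine m n') := by
  refine Set.disjoint_left.2 fun p hp ⟨hpn, hpn'⟩ ↦ hn ?_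
  obtain ⟨θ, hθ⟩ := hst.exists_mem_centralLine_iff hm hp
  exact ((hθ n).1 hpn).symm.trans ((hθ n').1 hpn')

theorem toExt_zero_notMem_celestialLine (hm : 0 < m) (hh : 2 ≤ h) (j : Fin h) (i : ℤ) :
    toExt 0 ∉ celestialLine s (celestialPoint m s t) j i := by
  rw [hst.celestialLine_eq_normalLine hm hh, toExt_zero_mem_normalLine_iff]
  exact (hst.apothem_pos j).ne'

theorem disjoint_centralLine_inter_celestialLine (hm : 0 < m) (hh : 2 ≤ h) (j : Fin h) (i : ℤ) :
    Disjoint (celestialPoints (celestialPoint m s t) ∪ Set.range (infinitePoint m))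
      (centralLine m (classOffset s t j + s j + 2 * i) ∩
        celestialLine s (celestialPoint m s t) j i) := by
  rw [hst.celestialLine_eq_normalLine hm hh]
  refine Set.disjoint_left.2 ?_
  rintro _ (⟨a, k, rfl⟩ | ⟨k, rfl⟩) ⟨hcentral, hnormal⟩
  · have not_dvd_s : ¬ (m : ℤ) ∣ s j := fun H ↦
      hst.not_dvd_two_mul_s j ((by exact_mod_cast H : m ∣ s j).mul_left 2)
    have not_dvd_t : ¬ (m : ℤ) ∣ t j := by exact_mod_cast hst.not_dvd_t j
    have next := hst.classOffset_finRotate j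
    rw [hst.celestialPoint_mem_centralLine_iff hm] at hcentral
    rw [hst.celestialPoint_mem_normalLine_iff hm hh] at hnormal
    simp only [Int.modEq_iff_dvd] at hcentral hnormal
    obtain ⟨d, hd⟩ := hcentral
    rcases hnormal with ⟨rfl, ⟨c, hc⟩ | ⟨c, hc⟩⟩ | ⟨rfl, ⟨c, hc⟩ | ⟨c, hc⟩⟩
    · exact not_dvd_s ⟨d - 2 * c, by linear_combination hd - 2 * hc⟩
    · exact not_dvd_s ⟨2 * c - d, by linear_combination 2 * hc - hd⟩
    · exact not_dvd_t ⟨d - 2 * c, by linear_combination hd - 2 * hc + next⟩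
    · exact not_dvd_t ⟨2 * c - d, by linear_combination 2 * hc - hd - next⟩
  · rw [infinitePoint_mem_centralLine_iff hm, ← sinMul_sub_eq_zero_iff hm] at hcentral
    rw [infinitePoint_mem_normalLine_iff] at hnormal
    simpa [hcentral, hnormal] using
      cosMul_sq_add_sinMul_sq (m := m) (k - (classOffset s t j + s j + 2 * i))

end

section Even

variable {h ℓ : ℕ} {s t : Fin h → ℕ} (hst : IsValidSymbol (2 * ℓ) s t)
include hst

theorem encard_sep_celestialPoints_mem_centralLine (hℓ : 0 < ℓ) (n : ℤ) :
    {p ∈ celestialPoints (celestialPoint (2 * ℓ) s t) | p ∈ centralLine (2 * ℓ) n}.encard =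
      {j | classOffset s t j ≡ n [ZMOD 2]}.encard * 2 := by
  have hm : 0 < 2 * ℓ := by positivity
  have eq_iff := hst.celestialPoint_eq_iff hm
  rw [← range_celestialPointMod eq_iff, encard_sep_range (celestialPointMod_injective eq_iff),
    ← encard_setOf_add_two_mul_modEq hℓ]
  simp only [celestialPointMod, hst.celestialPoint_mem_centralLine_iff hm, Nat.cast_mul,
    Nat.cast_two]

theorem encard_sep_celestialLines_infinitePoint_mem (hℓ : 0 < ℓ) (hh : 3 ≤ h) (k : ℤ) :
    {l ∈ celestialLines s (celestialPoint (2 * ℓ) s t) | infinitePoint (2 * ℓ) k ∈ l}.encard =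
      {j | classOffset s t j + s j ≡ k - ℓ [ZMOD 2]}.encard * 2 := by
  have hm : 0 < 2 * ℓ := by positivity
  have mem_iff := (hst.isCelestial hm hh).mem_iff
  rw [← range_celestialLineMod (hst.celestialPoint_eq_iff hm),
    encard_sep_range (celestialLineMod_injective mem_iff hh hst.not_dvd_two_mul_s),
    ← encard_setOf_add_two_mul_modEq hℓ]
  congr 1
  ext ⟨j, i⟩
  rw [Set.mem_ofPred_eq, celestialLineMod, hst.celestialLine_eq_normalLine hm (by omega),
    infinitePoint_mem_normalLine_iff, cosMul_two_mul_eq_zero_iff hℓ, Set.mem_ofPred_eq,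
    Int.modEq_comm, Int.modEq_iff_dvd, Int.modEq_iff_dvd, sub_right_comm, Nat.cast_mul,
    Nat.cast_two]

theorem isConfiguration_union_centralLine (hℓ : 0 < ℓ) (hh : 3 ≤ h)
    (hpoints : ∀ n, {j | classOffset s t j ≡ n [ZMOD 2]}.encard = 2)
    (hlines : ∀ n, {j | classOffset s t j + s j ≡ n [ZMOD 2]}.encard = 2) :
    IsConfiguration extLines (2 * ℓ * h + 2 * ℓ) 5
      (celestialPoints (celestialPoint (2 * ℓ) s t) ∪ Set.range (infinitePoint (2 * ℓ)))
      (celestialLines s (celestialPoint (2 * ℓ) s t) ∪ Set.range (centralLine (2 * ℓ))) := by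
  have hm : 0 < 2 * ℓ := by positivity
  refine (hst.isCelestial hm hh).isConfiguration.union
    (isConfiguration_infinitePoint_centralLine hm) ?_ ?_ ?_ ?_ ?_ ?_
  · rw [Set.disjoint_left]
    rintro _ ⟨j, i, rfl⟩ ⟨k, hk⟩
    exact toExt_notMem_lineAtInfinity _ (hk ▸ infinitePoint_mem_lineAtInfinity k)
  · rw [Set.disjoint_left]
    rintro _ ⟨j, i, rfl⟩ ⟨k, hk⟩
    exact hst.toExt_zero_notMem_celestialLine hm (by omega) j i (hk ▸ toExt_zero_mem_centralLine k)
  · rintro _ ⟨j, i, rfl⟩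
    rw [hst.celestialLine_eq_normalLine hm (by omega)]
    exact encard_sep_infinitePoint_mem_normalLine hℓ _ _
  · rintro _ ⟨n, rfl⟩
    rw [hst.encard_sep_celestialPoints_mem_centralLine hℓ, hpoints]
    norm_num
  · intro p hp
    obtain ⟨θ, hθ⟩ := hst.exists_mem_centralLine_iff hm (Or.inl hp)
    exact encard_sep_centralLine hm hθ
  · rintro _ ⟨k, rfl⟩
    rw [hst.encard_sep_celestialLines_infinitePoint_mem hℓ hh, hlines]
    norm_num

end Even

end IsValidSymbol

/-! ### Incidences of `D₄(ℓ)` -/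

section Construction

variable {ℓ : ℕ}

theorem basePoint_zero (i : ℤ) : basePoint ℓ 0 i = polar (2 * ℓ) 1 (2 * i) := by
  obtain ⟨I0, -⟩ := Iio_fin_four
  rw [basePoint, celestialPoint_eq_polar, classRadius, classOffset, I0, Finset.prod_empty,
    Finset.sum_empty, zero_add]

theorem diameters_union_midDiameters (hℓ : 0 < ℓ) :
    diameters ℓ ∪ midDiameters ℓ = Set.range (centralLine (2 * ℓ)) := by
  have hm : 0 < 2 * ℓ := by positivity
  have diameter (i : ℤ) :
      join (toExt 0) (toExt (basePoint ℓ 0 i)) = centralLine (2 * ℓ) (2 * i) := by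
    rw [basePoint_zero, join_toExt_zero_toExt_polar hm one_ne_zero]
  have midDiameter (i : ℤ) :
      join (toExt 0) (toExt (rotate (Real.pi / (2 * ℓ : ℕ)) (basePoint ℓ 0 i))) =
        centralLine (2 * ℓ) (2 * i + 1) := by
    have rotated := rotate_polar (m := 2 * ℓ) 1 (2 * i) 1
    rw [Int.cast_one, one_mul] at rotated
    rw [basePoint_zero, rotated, join_toExt_zero_toExt_polar hm one_ne_zero]
  ext l
  simp only [diameters, midDiameters, diameter, midDiameter]
  constructor
  · rintro (⟨i, rfl⟩ | ⟨i, rfl⟩) <;> exact ⟨_, rfl⟩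
  · rintro ⟨k, rfl⟩
    obtain ⟨i, rfl | rfl⟩ := Int.even_or_odd' k
    exacts [Or.inl ⟨i, rfl⟩, Or.inr ⟨i, rfl⟩]

theorem lines_eq (hℓ : 0 < ℓ) :
    lines ℓ = celestialLines spanS (basePoint ℓ) ∪ Set.range (centralLine (2 * ℓ)) := by
  rw [lines, Set.union_assoc, diameters_union_midDiameters hℓ]

theorem points_eq (hℓ : 0 < ℓ) :
    points ℓ = celestialPoints (basePoint ℓ) ∪ Set.range (infinitePoint (2 * ℓ)) := by
  rw [points, diameters_union_midDiameters hℓ]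
  congr 1
  ext x
  have eq_iff := fun k ↦ eq_infinitePoint_iff (by positivity : 0 < 2 * ℓ) (x := x) k
  constructor
  · rintro ⟨hx, _, ⟨k, rfl⟩, hxk⟩
    exact ⟨k, ((eq_iff k).2 ⟨hx, hxk⟩).symm⟩
  · rintro ⟨k, rfl⟩
    obtain ⟨hx, hxk⟩ := (eq_iff k).1 rfl
    exact ⟨hx, _, ⟨k, rfl⟩, hxk⟩

theorem encard_setOf_classOffset_modEq (n : ℤ) :
    {j | classOffset spanS spanT j ≡ n [ZMOD 2]}.encard = 2 := by
  rw [Set.encard_eq_coe_toFinset_card]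
  rcases Int.emod_two_eq_zero_or_one n with hn | hn <;>
    simp only [classOffset_spanS_spanT, Int.ModEq, hn, Set.toFinset_ofPred] <;> rfl

theorem encard_setOf_classOffset_add_modEq (n : ℤ) :
    {j | classOffset spanS spanT j + spanS j ≡ n [ZMOD 2]}.encard = 2 := by
  rw [Set.encard_eq_coe_toFinset_card]
  rcases Int.emod_two_eq_zero_or_one n with hn | hn <;>
    simp only [classOffset_spanS_spanT, Int.ModEq, hn, Set.toFinset_ofPred] <;> rfl

variable (hℓ : 5 ≤ ℓ)
include hℓ

theorem isConfiguration_points_lines :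
    IsConfiguration extLines (10 * ℓ) 5 (points ℓ) (lines ℓ) := by
  have h := (isValidSymbol_spanS_spanT (by omega : 9 ≤ 2 * ℓ)).isConfiguration_union_centralLine
    (by omega) (by norm_num) encard_setOf_classOffset_modEq encard_setOf_classOffset_add_modEq
  rw [points_eq (by omega), lines_eq (by omega), show 10 * ℓ = 2 * ℓ * 4 + 2 * ℓ by ring]
  exact h

theorem hasIndependentPencils_points_lines {g : (Fin 3 → ℝ) ≃ₗ[ℝ] (Fin 3 → ℝ)}
    (hg : IsSuitable g (points ℓ)) :
    HasIndependentPencils (project g (points ℓ)) (project g '' lines ℓ) 1 1 := by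
  have hm : 0 < 2 * ℓ := by omega
  have hst := isValidSymbol_spanS_spanT (by omega : 9 ≤ 2 * ℓ)
  have hlines := lines_eq (by omega : 0 < ℓ)
  have hpoints := points_eq (by omega : 0 < ℓ)
  have not_modEq : ¬ 2 ≡ 3 [ZMOD (2 * ℓ : ℕ)] := fun H ↦ by
    have := Int.eq_one_of_dvd_one (by positivity) H.dvd
    omega
  refine (isConfiguration_points_lines hℓ).hasIndependentPencils_one_one (by norm_num) hg
    (a := centralLine (2 * ℓ) 2) (b := centralLine (2 * ℓ) 3)
    (c := celestialLine spanS (basePoint ℓ) 0 0) (o := toExt 0) ?_ ?_ ?_ ?_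
    (toExt_zero_mem_centralLine 2) (toExt_zero_mem_centralLine 3)
    (hst.toExt_zero_notMem_celestialLine hm (by norm_num) 0 0) ?_ ?_
  · exact hlines ▸ Or.inr ⟨2, rfl⟩
  · exact hlines ▸ Or.inr ⟨3, rfl⟩
  · exact hlines ▸ Or.inl ⟨0, 0, rfl⟩
  · exact mt (centralLine_eq_iff hm 2 3).1 not_modEq
  · exact hpoints ▸ hst.disjoint_centralLine_inter_centralLine hm not_modEq
  · exact hpoints ▸ hst.disjoint_centralLine_inter_celestialLine hm (by norm_num) 0 0

end Construction

end D4Config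

theorem mainTheorem9 (ℓ : ℕ) (hℓ : 5 ≤ ℓ) :
    D4Config.IsCelestial (2 * ℓ) D4Config.spanS D4Config.spanT (D4Config.basePoint ℓ) ∧
    D4Config.IsConfiguration D4Config.extLines (10 * ℓ) 5
      (D4Config.points ℓ) (D4Config.lines ℓ) ∧
    (∀ g : (Fin 3 → ℝ) ≃ₗ[ℝ] (Fin 3 → ℝ), D4Config.IsSuitable g (D4Config.points ℓ) →
      D4Config.IsConfiguration D4Config.planeLines (10 * ℓ) 5
        (D4Config.project g (D4Config.points ℓ))
        (D4Config.project g '' D4Config.lines ℓ) ∧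
      D4Config.HasIndependentPencils
        (D4Config.project g (D4Config.points ℓ))
        (D4Config.project g '' D4Config.lines ℓ) 1 1) ∧
    (∃ g : (Fin 3 → ℝ) ≃ₗ[ℝ] (Fin 3 → ℝ), D4Config.IsSuitable g (D4Config.points ℓ) ∧
      ∀ p q : ℕ, D4Config.HasIndependentPencils
        (D4Config.project g (D4Config.points ℓ))
        (D4Config.project g '' D4Config.lines ℓ) p q → p ≤ 1 ∧ q ≤ 1) := by
  have hsymbol := D4Config.isValidSymbol_spanS_spanT (by omega : 9 ≤ 2 * ℓ)
  have hconf := D4Config.isConfiguration_points_lines hℓ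
  refine ⟨hsymbol.isCelestial (by omega) (by norm_num), hconf, fun g hg ↦ ⟨?_, ?_⟩, ?_⟩
  · exact hconf.image_project (by norm_num) hg
  · exact D4Config.hasIndependentPencils_points_lines hℓ hg
  · exact hconf.exists_isSuitable_pencils_le_one (by norm_num)
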